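/- For a positive integer $n$ let $\Phi_n(x)\in\mathbb Z[x]$ be the $n$-th cyclotomic polynomial. Call a polynomial with integer coefficients *flat* if the greatest absolute value of its coefficients is equal to $1$. Let $p<q<r<s$ be primes such that $r\equiv\pm1\pmod{pq}$ and $s\equiv\pm1\pmod{pqr}$ (the two signs being independent of each other). Then $\Phi_{pqrs}(x)$ is flat if and only if $q\equiv-1\pmod p$. -/

import Mathlib

/-- A polynomial with integer coefficients is *flat* if its height, that is, the greatest absolute
value of its coefficients (`Polynomial.supNorm`), is equal to `1`. -/
def Polynomial.IsFlat (f : Polynomial ℤ) : Prop :=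
  f.supNorm = 1

open Finset Polynomial

/-! Let φ = (p-1)(q-1) be the degree of Φ_{pq}. Since Φ_{nℓ}(X) = Φ_n(X^ℓ)/Φ_n(X) for a prime ℓ not
dividing n, each coefficient of Φ_{pqrs} pairs a truncation of Φ_{pqr} with the series 1/Φ_{pqr}.
That series has period pqr, so s ≡ 1 turns the pairing into the convolution `triConv`; its
antisymmetry reduces s ≡ -1 to the same convolution.

Now 1/Φ_{pqr} = Φ_{pq}(X)/Φ_{pq}(X^r). The product of Φ_{pq} with Φ_{pqr} truncated at degree K
agrees with Φ_{pq}(X^r) up to K and is followed by φ boundary coefficients (`triConv_eq`). Division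
by Φ_{pq}(X^r) sees only one residue class mod r, and φ < r, so at most one boundary coefficient
enters. Because r ≡ ±1 mod pq, it is up to sign a `truncProd`, which depends on p and q alone. So
flatness follows when every `truncProd` is at most 1 in absolute value (`abs_triConv_le`), and
conversely enough values of `truncProd` occur as coefficients up to sign (`exists_triConv_eq`).

If q is not -1 mod p, explicit short truncations give the value 2 (`exists_truncProd_eq_two`). If tp
= q+1, a truncation of Φ_{pq} is a sum of pairs `X ^ posExp p q t h - X ^ (h * p + 1)` with at most
one unpaired term. The identity `pairSum_mul_pairSum_mul_invNum` then replaces the triple product by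
eight signed sums of monomials. In the coordinates ℤ/p × ℤ/q each sum meets a given class at most
once, and comparing the conditions gives the bound 1 (`abs_sum_cell_le`). Reflection covers the case
where both truncations have an unpaired term. -/

/-! ### Linear functionals, truncations and residue classes of exponents -/

/-- The linear functional on integer polynomials sending `X ^ k` to `w k`. -/
noncomputable def polyEval (w : ℕ → ℤ) : ℤ[X] →ₗ[ℤ] ℤ :=
  Polynomial.lsum fun k => w k • LinearMap.id

theorem polyEval_apply_of_lt (w : ℕ → ℤ) (f : ℤ[X]) {N : ℕ} (hN : f.natDegree < N) :
    polyEval w f = ∑ k ∈ range N, f.coeff k * w k := by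
  simp only [polyEval, Polynomial.lsum_apply]
  rw [Polynomial.sum_over_range' f (by simp) N hN]
  simp [mul_comm]

theorem polyEval_X_pow (w : ℕ → ℤ) (k : ℕ) : polyEval w (X ^ k) = w k := by
  simp only [polyEval, Polynomial.lsum_apply]
  rw [← monomial_one_right_eq_X_pow, Polynomial.sum_monomial_index] <;> simp

theorem polyEval_X_pow_mul (w : ℕ → ℤ) (k : ℕ) (f : ℤ[X]) :
    polyEval w (X ^ k * f) = polyEval (fun j => w (k + j)) f := by
  induction f using Polynomial.induction_on' with
  | add f g hf hg => rw [mul_add, map_add, map_add, hf, hg]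
  | monomial n a =>
    rw [← C_mul_X_pow_eq_monomial, show X ^ k * (C a * X ^ n) = a • X ^ (k + n) by
      rw [smul_eq_C_mul, pow_add]; ring, ← smul_eq_C_mul, map_smul, map_smul, polyEval_X_pow,
      polyEval_X_pow]

theorem polyEval_mul (w : ℕ → ℤ) (f g : ℤ[X]) {N : ℕ} (hN : f.natDegree < N) :
    polyEval w (f * g) = ∑ k ∈ range N, f.coeff k * polyEval (fun j => w (k + j)) g := by
  conv_lhs => rw [f.as_sum_range' N hN, Finset.sum_mul, map_sum]
  refine Finset.sum_congr rfl fun k _ => ?_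
  rw [← C_mul_X_pow_eq_monomial, mul_assoc, ← smul_eq_C_mul, map_smul, polyEval_X_pow_mul,
    smul_eq_mul]

/-- The truncation of a polynomial to degrees less than `i`. -/
noncomputable def truncLT (i : ℕ) (f : ℤ[X]) : ℤ[X] := ∑ k ∈ range i, C (f.coeff k) * X ^ k

theorem coeff_truncLT (i : ℕ) (f : ℤ[X]) (k : ℕ) :
    (truncLT i f).coeff k = if k < i then f.coeff k else 0 := by
  simp [truncLT, coeff_X_pow]

theorem polyEval_truncLT_mul (w : ℕ → ℤ) (i : ℕ) (f g : ℤ[X]) :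
    polyEval w (truncLT i f * g) = ∑ k ∈ range i, f.coeff k * polyEval (fun j => w (k + j)) g := by
  rw [truncLT, Finset.sum_mul, map_sum]
  refine Finset.sum_congr rfl fun k _ => ?_
  rw [mul_assoc, ← smul_eq_C_mul, map_smul, polyEval_X_pow_mul, smul_eq_mul]

/-- The weight extracting the coefficient of residue class `u` modulo `n`. -/
def resWeight (n : ℕ) (u : ℤ) (k : ℕ) : ℤ := if (n : ℤ) ∣ u - k then 1 else 0

theorem polyEval_resWeight_X_pow_mul (n : ℕ) (u : ℤ) (k : ℕ) (f : ℤ[X]) :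
    polyEval (resWeight n u) (X ^ k * f) = polyEval (resWeight n (u - k)) f := by
  rw [polyEval_X_pow_mul]
  congr 2
  funext j
  simp [resWeight, sub_sub]

theorem polyEval_resWeight_one_sub (n : ℕ) (u : ℤ) (f : ℤ[X]) :
    polyEval (resWeight n u) ((1 - X ^ n) * f) = 0 := by
  rw [sub_mul, one_mul, map_sub, polyEval_resWeight_X_pow_mul, sub_eq_zero]
  congr 2
  funext j
  simp only [resWeight]
  congr 1
  rw [sub_right_comm, dvd_sub_self_right]

/-! ### The cyclotomic polynomial of order `p * q` -/

/-- The numerator of `1 / Φ_{pq}`, with denominator `1 - X ^ (p * q)`. -/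
noncomputable def invNum (p q : ℕ) : ℤ[X] := (∑ i ∈ range p, X ^ i) * (1 - X ^ q)

/-- Φ_{pq}(X) Φ_p(X) = Φ_p(X^q), and Φ_p(X^q)(1 - X^q) = 1 - X^{pq}. -/
theorem cyclotomic_mul_invNum {p q : ℕ} (hp : p.Prime) (hq : q.Prime) (hpq : p < q) :
    cyclotomic (p * q) ℤ * invNum p q = 1 - X ^ (p * q) := by
  have hdvd : ¬ q ∣ p := fun h => absurd (Nat.le_of_dvd hp.pos h) (by omega)
  have h1 := cyclotomic_expand_eq_cyclotomic_mul hq hdvd ℤ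
  have hpf : Fact p.Prime := ⟨hp⟩
  have h2 := cyclotomic_prime_mul_X_sub_one ℤ p
  have h3 := congrArg (expand ℤ q) h2
  simp only [map_mul, map_sub, expand_X, map_one, map_pow] at h3
  rw [h1] at h3
  rw [invNum, ← cyclotomic_prime ℤ p, mul_comm p q, pow_mul, mul_comm q p]
  linear_combination -h3

/-- The coefficients of the power series `1 / Φ_{pq}`, extended periodically to `ℤ`. -/
def invCoeff (p q : ℕ) (u : ℤ) : ℤ :=
  (if u % (p * q : ℕ) < p then 1 else 0) -
    (if q ≤ u % (p * q : ℕ) ∧ u % (p * q : ℕ) < q + p then 1 else 0)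

theorem coeff_invNum {p q : ℕ} (k : ℕ) :
    (invNum p q).coeff k = (if k < p then 1 else 0) - (if q ≤ k ∧ k < q + p then 1 else 0) := by
  have h : ∀ j, (∑ i ∈ range p, (X : ℤ[X]) ^ i).coeff j = if j < p then 1 else 0 := by
    intro j
    simp [coeff_X_pow]
  rw [invNum, mul_sub, mul_one, coeff_sub, coeff_mul_X_pow', h]
  congr 1
  by_cases hk : q ≤ k
  · rw [if_pos hk, h]
    congr 1
    simp only [eq_iff_iff]; omega
  · rw [if_neg hk, if_neg]; omega

theorem add_lt_mul_of_primes {p q : ℕ} (hp : 2 ≤ p) (hpq : p < q) : p + q ≤ p * q := by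
  nlinarith

theorem polyEval_invNum {p q : ℕ} (hp : 2 ≤ p) (hpq : p < q) (u : ℤ) :
    polyEval (resWeight (p * q) u) (invNum p q) = invCoeff p q u := by
  have hn := add_lt_mul_of_primes hp hpq
  have hpos : 0 < p * q := by omega
  have hdeg : (invNum p q).natDegree < p * q := by
    by_contra hcon
    have hne : (invNum p q).leadingCoeff ≠ 0 := by
      intro h0
      rw [leadingCoeff_eq_zero] at h0
      rw [h0] at hcon
      simp at hcon
      omega
    rw [leadingCoeff, coeff_invNum, if_neg (by omega), if_neg (by omega)] at hne
    simp at hne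
  rw [polyEval_apply_of_lt _ _ hdeg]
  have h0 := Int.emod_nonneg u (b := ((p * q : ℕ) : ℤ)) (by exact_mod_cast hpos.ne')
  have h1 := Int.emod_lt_of_pos u (b := ((p * q : ℕ) : ℤ)) (by exact_mod_cast hpos)
  rw [Finset.sum_eq_single (u % (p * q : ℕ)).toNat]
  · have h2 : ((p * q : ℕ) : ℤ) ∣ u - ((u % (p * q : ℕ)).toNat : ℕ) := by
      rw [Int.toNat_of_nonneg h0]
      exact Int.dvd_self_sub_emod
    rw [coeff_invNum, resWeight, if_pos h2, invCoeff, mul_one]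
    congr 2 <;> simp only [eq_iff_iff] <;> omega
  · intro k hk hne
    rw [resWeight, if_neg, mul_zero]
    intro hdvd
    apply hne
    have h2 : (k : ℤ) % (p * q : ℕ) = u % (p * q : ℕ) := Int.modEq_iff_dvd.2 hdvd
    rw [mem_range] at hk
    rw [Int.emod_eq_of_lt (by positivity) (by exact_mod_cast hk)] at h2
    omega
  · intro h
    exfalso
    apply h
    simp only [mem_range]
    omega

/-- The degree `(p - 1) * (q - 1)` of the cyclotomic polynomial of order `p * q`. -/
def primePhi (p q : ℕ) : ℕ := (p - 1) * (q - 1)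

theorem natDegree_cyclotomic_mul {p q : ℕ} (hp : p.Prime) (hq : q.Prime) (hpq : p < q) :
    (cyclotomic (p * q) ℤ).natDegree = primePhi p q := by
  rw [natDegree_cyclotomic, Nat.totient_mul ((Nat.coprime_primes hp hq).2 hpq.ne),
    Nat.totient_prime hp, Nat.totient_prime hq, primePhi]

theorem invCoeff_congr {p q : ℕ} {u v : ℤ} (h : ((p * q : ℕ) : ℤ) ∣ u - v) :
    invCoeff p q u = invCoeff p q v := by
  have h2 : v % (p * q : ℕ) = u % (p * q : ℕ) := Int.modEq_iff_dvd.2 h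
  rw [invCoeff, invCoeff, h2]

theorem abs_invCoeff_le (p q : ℕ) (u : ℤ) : |invCoeff p q u| ≤ 1 := by
  rw [invCoeff]
  split_ifs <;> simp

theorem invCoeff_of_lt {p q : ℕ} {u : ℤ} (h0 : 0 ≤ u) (h : u < (p * q : ℕ)) :
    invCoeff p q u = (if u < p then 1 else 0) - (if q ≤ u ∧ u < q + p then 1 else 0) := by
  rw [invCoeff, Int.emod_eq_of_lt h0 h]

theorem invCoeff_zero {p q : ℕ} (hp : 0 < p) (hpq : p < q) : invCoeff p q 0 = 1 := by
  have : 0 < p * q := Nat.mul_pos hp (by omega)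
  rw [invCoeff_of_lt le_rfl (by exact_mod_cast this), if_pos (by exact_mod_cast hp), if_neg]
  · simp
  · omega

theorem phi_add {p q : ℕ} (hp : 2 ≤ p) (hpq : p < q) :
    primePhi p q + (p + q) = p * q + 1 := by
  obtain ⟨a, rfl⟩ : ∃ a, p = a + 1 := ⟨p - 1, by omega⟩
  obtain ⟨b, rfl⟩ : ∃ b, q = b + 1 := ⟨q - 1, by omega⟩
  simp only [primePhi, Nat.add_sub_cancel]
  ring

/-- The numerator has degree p+q-1 = pq-φ, so each period ends in a gap of φ-1 zeros. This gap is
what allows summation ranges to be lengthened for free later on. -/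
theorem invCoeff_neg_eq_zero {p q : ℕ} (hp : 2 ≤ p) (hpq : p < q) {w : ℤ} (h0 : w < 0)
    (h : -(primePhi p q : ℤ) < w) : invCoeff p q w = 0 := by
  have h1 := phi_add hp hpq
  rw [invCoeff_congr (v := w + (p * q : ℕ)) ⟨-1, by ring⟩, invCoeff_of_lt (by omega) (by omega),
    if_neg (by omega), if_neg (by omega), sub_zero]

/-- The numerator is antipalindromic of degree p+q-1, and p+q-1 ≡ -φ mod pq. -/
theorem invCoeff_symm {p q : ℕ} (hp : 2 ≤ p) (hpq : p < q) (u : ℤ) :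
    invCoeff p q (-(primePhi p q : ℤ) - u) = -invCoeff p q u := by
  have h1 := phi_add hp hpq
  have hn := add_lt_mul_of_primes hp hpq
  have h0 := Int.emod_nonneg u (b := ((p * q : ℕ) : ℤ)) (by omega)
  have h2 := Int.emod_lt_of_pos u (b := ((p * q : ℕ) : ℤ)) (by omega)
  rw [invCoeff_congr (u := u) (v := u % (p * q : ℕ)) Int.dvd_self_sub_emod,
    invCoeff_of_lt h0 h2]
  have h3 : ((p * q : ℕ) : ℤ) ∣ u - u % (p * q : ℕ) := Int.dvd_self_sub_emod
  set z := u % (p * q : ℕ)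
  obtain ⟨c, hc⟩ := h3
  generalize hn' : p * q = n at *
  generalize primePhi p q = φ at *
  by_cases hz : z ≤ p + q - 1
  · rw [invCoeff_congr (v := (p : ℤ) + q - 1 - z)
      ⟨-1 - c, by rw [hn']; zify at h1; linear_combination -hc - h1⟩,
      invCoeff_of_lt (by omega) (by omega)]
    split_ifs <;> omega
  · rw [invCoeff_congr (v := (p : ℤ) + q - 1 - z + n)
      ⟨-2 - c, by rw [hn']; zify at h1; linear_combination -hc - h1⟩,
      invCoeff_of_lt (by omega) (by omega)]
    split_ifs <;> omega

section
variable {p q : ℕ} (hp : p.Prime) (hq : q.Prime) (hpq : p < q)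
include hp hq hpq

theorem sum_coeff_mul_invCoeff (u : ℤ) :
    ∑ e ∈ range (primePhi p q + 1), (cyclotomic (p * q) ℤ).coeff e * invCoeff p q (u - e)
      = 0 := by
  have h := polyEval_mul (resWeight (p * q) u) (cyclotomic (p * q) ℤ) (invNum p q)
    (Nat.lt_succ_self _)
  rw [cyclotomic_mul_invNum hp hq hpq, ← mul_one (1 - X ^ (p * q)),
    polyEval_resWeight_one_sub, natDegree_cyclotomic_mul hp hq hpq] at h
  rw [h]
  refine Finset.sum_congr rfl fun e _ => ?_
  rw [← polyEval_invNum hp.two_le hpq]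
  congr 3
  funext j
  simp [resWeight, sub_sub]

theorem cyclotomic_mul_mk_invCoeff :
    (cyclotomic (p * q) ℤ : PowerSeries ℤ) * PowerSeries.mk (fun k => invCoeff p q k) = 1 := by
  have hn := add_lt_mul_of_primes hp.two_le hpq
  have h1 : (1 - PowerSeries.X ^ (p * q) : PowerSeries ℤ) *
      PowerSeries.mk (fun k => invCoeff p q k) = (invNum p q : PowerSeries ℤ) := by
    ext k
    rw [sub_mul, one_mul, map_sub, PowerSeries.coeff_X_pow_mul', PowerSeries.coeff_mk,
      Polynomial.coeff_coe, coeff_invNum]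
    split_ifs with h h2 h3 h3 h2 h3 h3
    all_goals first
      | omega
      | (rw [PowerSeries.coeff_mk, invCoeff_congr (u := k) (v := (k - p * q : ℕ))]
         · simp
         · push_cast [h]
           simp)
      | (rw [invCoeff_of_lt (by positivity) (by omega)]
         split_ifs <;> first | rfl | omega)
  have h2 : (1 - PowerSeries.X ^ (p * q) : PowerSeries ℤ) ≠ 0 := by
    intro h
    have := congrArg (PowerSeries.coeff 0) h
    rw [map_sub, PowerSeries.coeff_X_pow, if_neg (by omega)] at this
    simp at this
  apply mul_left_cancel₀ h2
  rw [mul_left_comm, h1, ← Polynomial.coe_mul, cyclotomic_mul_invNum hp hq hpq]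
  simp

/-- Both `invNum` and 1 - X^{pq} change sign under reversal, so their quotient Φ_{pq} is
palindromic. -/
theorem coeff_cyclotomic_symm {e : ℕ} (he : e ≤ primePhi p q) :
    (cyclotomic (p * q) ℤ).coeff (primePhi p q - e) = (cyclotomic (p * q) ℤ).coeff e := by
  have hn := add_lt_mul_of_primes hp.two_le hpq
  have h := cyclotomic_mul_invNum hp hq hpq
  have hΘ : (invNum p q).reverse = - invNum p q := by
    have hdeg : (invNum p q).natDegree = p + q - 1 := by
      apply le_antisymm
      · rw [natDegree_le_iff_coeff_eq_zero]
        intro k hk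
        rw [coeff_invNum, if_neg (by omega), if_neg (by omega), sub_zero]
      · apply le_natDegree_of_ne_zero
        have := hp.two_le
        rw [coeff_invNum, if_neg (by omega), if_pos (by omega)]
        simp
    ext k
    rw [coeff_reverse, hdeg, coeff_neg, coeff_invNum, coeff_invNum]
    have := hp.two_le
    by_cases hk : k ≤ p + q - 1
    · rw [revAt_le hk]
      split_ifs <;> omega
    · rw [revAt_eq_self_of_lt (by omega)]
      split_ifs <;> omega
  have hX : (1 - X ^ (p * q) : ℤ[X]).reverse = - (1 - X ^ (p * q)) := by
    have hdeg : (1 - X ^ (p * q) : ℤ[X]).natDegree = p * q := by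
      rw [natDegree_sub_eq_right_of_natDegree_lt] <;> simp
      constructor
      · exact hp.pos
      · exact hq.pos
    have hpos : 0 < p * q := by have := hp.two_le; omega
    ext k
    rw [coeff_reverse, hdeg, coeff_neg, coeff_sub, coeff_sub, coeff_X_pow, coeff_X_pow,
      coeff_one, coeff_one]
    by_cases hk : k ≤ p * q
    · rw [revAt_le hk]
      split_ifs <;> omega
    · rw [revAt_eq_self_of_lt (by omega)]
      split_ifs <;> omega
  have h3 := congrArg reverse h
  rw [reverse_mul_of_domain, hΘ, hX, ← h, mul_neg, neg_inj] at h3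
  have hne : invNum p q ≠ 0 := by
    intro h0
    have := congrArg (fun f => coeff f 0) h0
    have hq0 : ¬ (q ≤ 0 ∧ 0 < q + p) := by omega
    simp [coeff_invNum, hp.pos, hq.ne_zero] at this
  have h4 := mul_right_cancel₀ hne h3
  conv_rhs => rw [← h4, coeff_reverse, natDegree_cyclotomic_mul hp hq hpq, revAt_le he]

end

/-! ### Multiplying the order by a prime -/

theorem sum_range_dvd {r : ℕ} (hr : 0 < r) (k : ℕ) (F : ℕ → ℤ) :
    ∑ i ∈ range (k + 1), (if r ∣ i then F i else 0) = ∑ j ∈ range (k / r + 1), F (r * j) := by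
  rw [← Finset.sum_filter]
  symm
  refine Finset.sum_nbij (fun j => r * j) ?_ ?_ ?_ (fun _ _ => rfl)
  · intro j hj
    simp only [mem_range, mem_filter] at hj ⊢
    refine ⟨?_, dvd_mul_right _ _⟩
    have h1 : j ≤ k / r := by omega
    have := (Nat.le_div_iff_mul_le hr).1 h1
    rw [mul_comm]; omega
  · intro a _ b _ h
    exact Nat.eq_of_mul_eq_mul_left hr h
  · intro i hi
    simp only [coe_filter, mem_range, Set.mem_ofPred_eq] at hi
    obtain ⟨h1, j, rfl⟩ := hi
    refine ⟨j, ?_, rfl⟩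
    simp only [coe_range, Set.mem_Iio]
    have := (Nat.le_div_iff_mul_le hr (x := j) (y := k)).2 (by rw [mul_comm]; omega)
    omega

theorem coeff_cyclotomic_mul_prime {n r : ℕ} (hr : r.Prime) (hn : ¬ r ∣ n) (g : ℤ → ℤ)
    (hg : (cyclotomic n ℤ : PowerSeries ℤ) * PowerSeries.mk (fun k => g k) = 1) (k : ℕ) :
    (cyclotomic (n * r) ℤ).coeff k =
      ∑ j ∈ range (k / r + 1), (cyclotomic n ℤ).coeff j * g (k - r * j) := by
  have h1 := congrArg (fun f : ℤ[X] => (f : PowerSeries ℤ))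
    (cyclotomic_expand_eq_cyclotomic_mul hr hn ℤ)
  simp only [Polynomial.coe_mul] at h1
  have h2 : (cyclotomic (n * r) ℤ : PowerSeries ℤ) =
      (expand ℤ r (cyclotomic n ℤ) : PowerSeries ℤ) * PowerSeries.mk (fun k => g k) := by
    rw [h1, mul_assoc, hg, mul_one]
  rw [← Polynomial.coeff_coe, h2, PowerSeries.coeff_mul,
    Finset.Nat.sum_antidiagonal_eq_sum_range_succ_mk]
  trans ∑ i ∈ range (k + 1), (if r ∣ i then (cyclotomic n ℤ).coeff (i / r) * g (k - i) else 0)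
  · refine Finset.sum_congr rfl fun i hi => ?_
    have hik : i ≤ k := by simp at hi; omega
    rw [Polynomial.coeff_coe, coeff_expand hr.pos, PowerSeries.coeff_mk, Nat.cast_sub hik]
    split_ifs <;> simp
  · rw [sum_range_dvd hr.pos]
    refine Finset.sum_congr rfl fun j _ => ?_
    rw [Nat.mul_div_cancel_left _ hr.pos]
    push_cast
    rfl

/-- The coefficient sequence of `f(x) * g(x ^ r)`, for a sequence `g` indexed by `ℤ`. -/
noncomputable def expandCoeff (f : ℤ[X]) (g : ℤ → ℤ) (r : ℕ) (h : ℤ) : ℤ :=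
  ∑ e ∈ range (f.natDegree + 1), f.coeff e * (if (r : ℤ) ∣ h - e then g ((h - e) / r) else 0)

theorem coeff_mul_eq_sum_range (f g : ℤ[X]) (t : ℕ) :
    (f * g).coeff t =
      ∑ e ∈ range (f.natDegree + 1), f.coeff e * (if e ≤ t then g.coeff (t - e) else 0) := by
  conv_lhs => rw [f.as_sum_range_C_mul_X_pow, Finset.sum_mul, finsetSum_coeff]
  refine Finset.sum_congr rfl fun e _ => ?_
  rw [mul_assoc, coeff_C_mul, coeff_X_pow_mul']

theorem coeff_coe_mul_eq_sum_range (f : ℤ[X]) (g : PowerSeries ℤ) (t : ℕ) :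
    PowerSeries.coeff t ((f : PowerSeries ℤ) * g) = ∑ e ∈ range (f.natDegree + 1),
      f.coeff e * (if e ≤ t then PowerSeries.coeff (t - e) g else 0) := by
  conv_lhs => rw [f.as_sum_range_C_mul_X_pow]
  rw [← Polynomial.coeToPowerSeries.ringHom_apply, map_sum, Finset.sum_mul, map_sum]
  refine Finset.sum_congr rfl fun e _ => ?_
  rw [Polynomial.coeToPowerSeries.ringHom_apply, Polynomial.coe_mul, Polynomial.coe_C,
    Polynomial.coe_pow, Polynomial.coe_X, mul_assoc, PowerSeries.coeff_C_mul,
    PowerSeries.coeff_X_pow_mul']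

/-- This is 1/Φ_{nr}(X) = Φ_n(X)/Φ_n(X^r). -/
theorem cyclotomic_mul_mk_expandCoeff {n r : ℕ} (hr : r.Prime) (hn : ¬ r ∣ n) (g : ℤ → ℤ)
    (hg : (cyclotomic n ℤ : PowerSeries ℤ) * PowerSeries.mk (fun k => g k) = 1)
    (hdeg : (cyclotomic n ℤ).natDegree < r) :
    (cyclotomic (n * r) ℤ : PowerSeries ℤ) *
      PowerSeries.mk (fun k => expandCoeff (cyclotomic n ℤ) g r k) = 1 := by
  have h1 := congrArg (fun f : ℤ[X] => (f : PowerSeries ℤ))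
    (cyclotomic_expand_eq_cyclotomic_mul hr hn ℤ)
  simp only [Polynomial.coe_mul] at h1
  have h2 : (PowerSeries.mk (fun k => expandCoeff (cyclotomic n ℤ) g r k)) =
      (cyclotomic n ℤ : PowerSeries ℤ) *
        PowerSeries.expand r hr.ne_zero (PowerSeries.mk (fun k => g k)) := by
    ext t
    rw [PowerSeries.coeff_mk, coeff_coe_mul_eq_sum_range, expandCoeff]
    refine Finset.sum_congr rfl fun e he => ?_
    rw [mem_range] at he
    congr 1
    by_cases het : e ≤ t
    · rw [if_pos het, PowerSeries.coeff_expand, ← Nat.cast_sub het]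
      simp only [Int.natCast_dvd_natCast]
      congr 1
      rw [PowerSeries.coeff_mk]
      push_cast
      rfl
    -- Here -r < t - e < 0 because e ≤ deg Φ_n < r, so r does not divide it: negative arguments of
    -- `g` never contribute.
    · rw [if_neg het, if_neg]
      intro hd
      have := Int.le_of_dvd (a := r) (b := (e : ℤ) - t) (by omega) (by
        rw [← neg_sub]; exact (dvd_neg).2 hd)
      omega
  have h3 : (expand ℤ r (cyclotomic n ℤ) : PowerSeries ℤ) =
      PowerSeries.expand r hr.ne_zero (cyclotomic n ℤ : PowerSeries ℤ) := by
    ext t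
    rw [Polynomial.coeff_coe, coeff_expand hr.pos, PowerSeries.coeff_expand]
    simp
  rw [h2, ← mul_assoc, ← h1, h3, ← map_mul, hg, map_one]

/-! ### Products of two truncations of Φ_{pq} with its inverse -/

/-- The coefficients of the cyclotomic polynomial of order `p * q`. -/
noncomputable def phiCoeff (p q k : ℕ) : ℤ := (cyclotomic (p * q) ℤ).coeff k

/-- The coefficient of residue class `u` modulo `p * q` in the product of `1 - X ^ (p * q)`, of
`1 / Φ_{pq}`, and of two truncations of `Φ_{pq}`, to degrees less than `i` and `J`. -/
noncomputable def truncProd (p q i J : ℕ) (u : ℤ) : ℤ :=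
  ∑ e ∈ range i, phiCoeff p q e * ∑ l ∈ range J, phiCoeff p q l * invCoeff p q (u - e - l)

section
variable {p q : ℕ} (hp : p.Prime) (hq : q.Prime) (hpq : p < q)
include hp hq hpq

theorem phiCoeff_eq_zero {k : ℕ} (hk : primePhi p q < k) : phiCoeff p q k = 0 :=
  coeff_eq_zero_of_natDegree_lt (by rwa [natDegree_cyclotomic_mul hp hq hpq])

theorem sum_phiCoeff_of_lt {J : ℕ} (hJ : primePhi p q < J) (F : ℕ → ℤ) :
    ∑ l ∈ range J, phiCoeff p q l * F l =
      ∑ l ∈ range (primePhi p q + 1), phiCoeff p q l * F l := by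
  symm
  apply Finset.sum_subset
  · intro x hx; simp at hx ⊢; omega
  · intro x _ hx
    rw [phiCoeff_eq_zero hp hq hpq (by simp at hx; omega), zero_mul]

theorem sum_phiCoeff_invCoeff {J : ℕ} (hJ : primePhi p q < J) (u : ℤ) :
    ∑ l ∈ range J, phiCoeff p q l * invCoeff p q (u - l) = 0 := by
  rw [sum_phiCoeff_of_lt hp hq hpq hJ]
  exact sum_coeff_mul_invCoeff hp hq hpq u

theorem phiCoeff_symm {e : ℕ} (he : e ≤ primePhi p q) :
    phiCoeff p q (primePhi p q - e) = phiCoeff p q e :=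
  coeff_cyclotomic_symm hp hq hpq he

/-- By palindromy, reflecting a head of Φ_{pq} gives a tail, which is the whole minus the
complementary head. -/
theorem sum_phiCoeff_reflect {J : ℕ} (hJ : J ≤ primePhi p q + 1) (F : ℕ → ℤ) :
    ∑ l ∈ range J, phiCoeff p q l * F (primePhi p q - l) =
      ∑ l ∈ range (primePhi p q + 1), phiCoeff p q l * F l -
        ∑ l ∈ range (primePhi p q + 1 - J), phiCoeff p q l * F l := by
  rw [eq_sub_iff_add_eq, add_comm, ← Finset.sum_range_add_sum_Ico _
    (Nat.sub_le (primePhi p q + 1) J), add_right_inj]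
  refine Finset.sum_nbij' (fun l => primePhi p q - l) (fun l => primePhi p q - l) ?_ ?_ ?_ ?_ ?_
  · intro l hl; simp at hl ⊢; omega
  · intro l hl; simp at hl ⊢; omega
  · intro l hl; simp at hl ⊢; omega
  · intro l hl; simp at hl ⊢; omega
  · intro l hl
    simp at hl
    rw [phiCoeff_symm hp hq hpq (by omega)]

omit hq in
theorem phiCoeff_zero : phiCoeff p q 0 = 1 :=
  cyclotomic_coeff_zero ℤ (by nlinarith [hp.two_le])

/-- Truncated sums against `1 / Φ_{pq}` agree with the full convolution in low degrees. -/
theorem sum_phiCoeff_invCoeff_of_le {J : ℕ} {v : ℤ} (h1 : v ≤ J) (h2 : J < v + primePhi p q) :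
    ∑ l ∈ range (J + 1), phiCoeff p q l * invCoeff p q (v - l) = if v = 0 then 1 else 0 := by
  rcases lt_or_ge v 0 with hv | hv
  · rw [if_neg (by omega)]
    refine Finset.sum_eq_zero fun l hl => ?_
    rw [mem_range] at hl
    rw [invCoeff_neg_eq_zero hp.two_le hpq (by omega) (by omega), mul_zero]
  · lift v to ℕ using hv
    have h := congrArg (PowerSeries.coeff v) (cyclotomic_mul_mk_invCoeff hp hq hpq)
    rw [PowerSeries.coeff_mul, Finset.Nat.sum_antidiagonal_eq_sum_range_succ_mk,
      PowerSeries.coeff_one] at h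
    rw [← Finset.sum_range_add_sum_Ico _ (show v + 1 ≤ J + 1 by omega), Finset.sum_eq_zero
      (s := Ico _ _), add_zero]
    · simp only [Nat.cast_eq_zero, ← h]
      refine Finset.sum_congr rfl fun l hl => ?_
      rw [mem_range] at hl
      rw [Polynomial.coeff_coe, PowerSeries.coeff_mk, Nat.cast_sub (by omega), phiCoeff]
    · intro l hl
      rw [mem_Ico] at hl
      rw [invCoeff_neg_eq_zero hp.two_le hpq (by omega) (by omega), mul_zero]

omit hq in
theorem truncProd_one (J : ℕ) (u : ℤ) :
    truncProd p q 1 J u = ∑ l ∈ range J, phiCoeff p q l * invCoeff p q (u - l) := by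
  simp [truncProd, phiCoeff_zero hp hpq]

/-- The product of one truncation with the reflection of another is again a product of
truncations. -/
theorem sum_sum_add_eq_neg_truncProd (i J : ℕ) (u : ℤ) :
    ∑ e ∈ range i, phiCoeff p q e * ∑ l ∈ range J, phiCoeff p q l * invCoeff p q (u - e + l) =
      -truncProd p q i (primePhi p q + 1 - J) (u + primePhi p q) := by
  rw [truncProd, ← Finset.sum_neg_distrib]
  refine Finset.sum_congr rfl fun e _ => ?_
  rw [← mul_neg]
  congr 1
  have key : ∀ J ≤ primePhi p q + 1,
      ∑ l ∈ range J, phiCoeff p q l * invCoeff p q (u - e + l) =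
        -∑ l ∈ range (primePhi p q + 1 - J),
          phiCoeff p q l * invCoeff p q (u + primePhi p q - e - l) := by
    intro J hJ
    have h := sum_phiCoeff_reflect hp hq hpq hJ
      (fun l => invCoeff p q (u + primePhi p q - e - l))
    rw [sum_phiCoeff_invCoeff hp hq hpq (Nat.lt_succ_self _), zero_sub] at h
    rw [← h]
    refine Finset.sum_congr rfl fun l hl => ?_
    rw [mem_range] at hl
    rw [Nat.cast_sub (by omega)]
    congr 2
    ring
  rcases le_or_gt J (primePhi p q + 1) with hJ | hJ
  · exact key J hJ
  · rw [sum_phiCoeff_of_lt hp hq hpq (by omega), key _ le_rfl,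
      Nat.sub_eq_zero_of_le hJ.le, Nat.sub_self]

/-- Each truncation is exchanged for its complement. Each exchange changes the sign, since full sums
against 1/Φ_{pq} vanish, and the antisymmetry of `invCoeff` supplies a third sign. -/
theorem truncProd_reflect {i J : ℕ} (hi : i ≤ primePhi p q + 1)
    (u : ℤ) : truncProd p q i J u =
      -truncProd p q (primePhi p q + 1 - i) (primePhi p q + 1 - J) (primePhi p q - u) := by
  have h1 := sum_sum_add_eq_neg_truncProd hp hq hpq (primePhi p q + 1 - i) J (-u)
  rw [show -u + primePhi p q = primePhi p q - u by ring] at h1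
  rw [← h1]
  have h2 := sum_phiCoeff_reflect hp hq hpq (J := primePhi p q + 1 - i) (by omega)
    (fun e => ∑ l ∈ range J, phiCoeff p q l * invCoeff p q (u - e - l))
  rw [Nat.sub_sub_self hi] at h2
  have h3 : ∑ e ∈ range (primePhi p q + 1), phiCoeff p q e *
      ∑ l ∈ range J, phiCoeff p q l * invCoeff p q (u - e - l) = 0 := by
    simp only [Finset.mul_sum]
    rw [Finset.sum_comm]
    refine Finset.sum_eq_zero fun l _ => ?_
    have := sum_phiCoeff_invCoeff hp hq hpq (Nat.lt_succ_self _) (u - l)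
    rw [← mul_zero (phiCoeff p q l), ← this, Finset.mul_sum]
    refine Finset.sum_congr rfl fun e _ => ?_
    rw [sub_right_comm]
    ring
  rw [h3, zero_sub] at h2
  rw [truncProd, ← neg_inj, ← h2, ← Finset.sum_neg_distrib]
  refine Finset.sum_congr rfl fun e he => ?_
  rw [mem_range] at he
  rw [← mul_neg, ← Finset.sum_neg_distrib]
  congr 1
  refine Finset.sum_congr rfl fun l _ => ?_
  rw [← mul_neg, ← invCoeff_symm hp.two_le hpq, Nat.cast_sub (by omega)]
  congr 2
  ring

end

/-! ### Truncations of Φ_{pqr} and their boundary coefficients -/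

/-- The coefficients of the cyclotomic polynomial of order `p * q * r`. -/
noncomputable def triCoeff (p q r k : ℕ) : ℤ := (cyclotomic (p * q * r) ℤ).coeff k

/-- The coefficients of `1 / Φ_{pqr}`, extended to `ℤ`. -/
noncomputable def triInv (p q r : ℕ) (h : ℤ) : ℤ :=
  expandCoeff (cyclotomic (p * q) ℤ) (invCoeff p q) r h

/-- The value at `h` of the convolution of a truncation of `Φ_{pqr}` with `1 / Φ_{pqr}`. -/
noncomputable def triConv (p q r K : ℕ) (h : ℤ) : ℤ :=
  ∑ j ∈ range (K + 1), triCoeff p q r j * triInv p q r (h - j)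

/-- The part of the coefficient of `Φ_{pqr}` at `x` coming from the terms of `Φ_{pq}(X ^ r)` of
degree at most `K`. -/
noncomputable def partCoeff (p q r K : ℕ) (x : ℤ) : ℤ :=
  ∑ l ∈ range (K / r + 1), phiCoeff p q l * invCoeff p q (x - r * l)

/-- The boundary coefficients of the product of `Φ_{pq}` and a truncation of `Φ_{pqr}`. -/
noncomputable def boundaryCoeff (p q r K d : ℕ) : ℤ :=
  -∑ e ∈ range d, phiCoeff p q e * partCoeff p q r K ((K + d : ℕ) - e)

section
variable {p q r : ℕ} (hp : p.Prime) (hq : q.Prime) (hr : r.Prime) (hpq : p < q) (hqr : q < r)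
  (hphi : primePhi p q < r)
include hp hq hr hpq hqr hphi

omit hphi in
theorem not_dvd_mul_of_lt : ¬ r ∣ p * q := by
  intro h
  rcases (hr.dvd_mul).1 h with h | h
  · exact absurd (Nat.le_of_dvd hp.pos h) (by omega)
  · exact absurd (Nat.le_of_dvd hq.pos h) (by omega)

theorem triInv_spec : (cyclotomic (p * q * r) ℤ : PowerSeries ℤ) *
    PowerSeries.mk (fun k => triInv p q r k) = 1 :=
  cyclotomic_mul_mk_expandCoeff hr (not_dvd_mul_of_lt hp hq hr hpq hqr) _
    (cyclotomic_mul_mk_invCoeff hp hq hpq) (by rwa [natDegree_cyclotomic_mul hp hq hpq])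

omit hr hqr hphi in
theorem triInv_eq (h : ℤ) : triInv p q r h = ∑ e ∈ range (primePhi p q + 1),
    phiCoeff p q e * (if (r : ℤ) ∣ h - e then invCoeff p q ((h - e) / r) else 0) := by
  rw [triInv, expandCoeff, natDegree_cyclotomic_mul hp hq hpq]
  rfl

omit hqr hphi in
theorem triInv_congr {h h' : ℤ} (hh : ((p * q * r : ℕ) : ℤ) ∣ h - h') :
    triInv p q r h = triInv p q r h' := by
  obtain ⟨c, hc⟩ := hh
  have hr0 : (r : ℤ) ≠ 0 := by exact_mod_cast hr.ne_zero
  rw [triInv_eq hp hq hpq, triInv_eq hp hq hpq]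
  refine Finset.sum_congr rfl fun e _ => ?_
  congr 1
  have h1 : h - e = h' - e + (p * q * c) * r := by push_cast at hc; linear_combination hc
  rw [h1, Int.add_mul_ediv_right _ _ hr0]
  simp only [Int.dvd_add_mul_self]
  split_ifs
  · apply invCoeff_congr
    exact ⟨c, by push_cast; ring⟩
  · rfl

omit hqr hphi in
theorem triInv_symm (h : ℤ) :
    triInv p q r (-(primePhi p q * (r - 1)) - h) = -triInv p q r h := by
  have hr0 : (r : ℤ) ≠ 0 := by exact_mod_cast hr.ne_zero
  have h1 := sum_phiCoeff_reflect hp hq hpq le_rfl (fun e =>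
    if (r : ℤ) ∣ (-(primePhi p q * (r - 1)) - h) - e then
      invCoeff p q (((-(primePhi p q * (r - 1)) - h) - e) / r) else 0)
  rw [Nat.sub_self, Finset.sum_range_zero, sub_zero] at h1
  rw [triInv_eq hp hq hpq, triInv_eq hp hq hpq, ← h1, ← Finset.sum_neg_distrib]
  refine Finset.sum_congr rfl fun e he => ?_
  rw [mem_range] at he
  rw [Nat.cast_sub (by omega)]
  refine Eq.trans ?_ (mul_neg _ _)
  congr 1
  by_cases hd : (r : ℤ) ∣ h - e
  · obtain ⟨c, hc⟩ := hd
    have h2 : -(primePhi p q * ((r : ℤ) - 1)) - h - (primePhi p q - e) =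
      r * (-primePhi p q - c) := by linear_combination -hc
    rw [h2, hc, if_pos (dvd_mul_right _ _), if_pos (dvd_mul_right _ _),
      Int.mul_ediv_cancel_left _ hr0, Int.mul_ediv_cancel_left _ hr0, invCoeff_symm hp.two_le hpq]
  · rw [if_neg hd, if_neg, neg_zero]
    intro h2
    apply hd
    have h3 : h - e = -(-(primePhi p q * ((r : ℤ) - 1)) - h - (primePhi p q - e)) -
      r * primePhi p q := by ring
    rw [h3]
    exact dvd_sub (dvd_neg.2 h2) (dvd_mul_right _ _)

omit hphi in
-- The additional terms have j < rl ≤ K, so their arguments j - rl lie in the zero gap of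
-- `invCoeff`.
theorem triCoeff_eq_partCoeff {K j : ℕ} (hj : j ≤ K) (hK : K < j + primePhi p q) :
    triCoeff p q r j = partCoeff p q r K j := by
  rw [triCoeff, coeff_cyclotomic_mul_prime hr (not_dvd_mul_of_lt hp hq hr hpq hqr) _
    (cyclotomic_mul_mk_invCoeff hp hq hpq), partCoeff]
  apply Finset.sum_subset
  · apply Finset.range_subset_range.2
    have := Nat.div_le_div_right (c := r) hj
    omega
  · intro l hl hl'
    rw [mem_range] at hl hl'
    have h1 : r * l ≤ K := by
      rw [mul_comm]; exact (Nat.le_div_iff_mul_le hr.pos).1 (by omega)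
    have h2 : j < r * l := by
      rw [mul_comm]; exact (Nat.div_lt_iff_lt_mul hr.pos).1 (by omega)
    zify at h1 h2
    rw [invCoeff_neg_eq_zero hp.two_le hpq (by omega) (by omega), mul_zero]

omit hq hqr hphi in
theorem partCoeff_neg_eq_zero {K : ℕ} {x : ℤ} (hx : x < 0) (hK : K < x + primePhi p q) :
    partCoeff p q r K x = 0 := by
  refine Finset.sum_eq_zero fun l hl => ?_
  rw [mem_range] at hl
  have h1 : r * l ≤ K := by
    rw [mul_comm]; exact (Nat.le_div_iff_mul_le hr.pos).1 (by omega)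
  zify at h1
  have h2 : (0 : ℤ) ≤ r * l := by positivity
  rw [invCoeff_neg_eq_zero hp.two_le hpq (by omega) (by omega), mul_zero]

omit hr hqr hphi in
theorem sum_phiCoeff_partCoeff (K : ℕ) (x : ℤ) :
    ∑ e ∈ range (primePhi p q + 1), phiCoeff p q e * partCoeff p q r K (x - e) = 0 := by
  simp only [partCoeff, Finset.mul_sum]
  rw [Finset.sum_comm]
  refine Finset.sum_eq_zero fun l _ => ?_
  have := sum_phiCoeff_invCoeff hp hq hpq (Nat.lt_succ_self _) (x - r * l)
  rw [← mul_zero (phiCoeff p q l), ← this, Finset.mul_sum]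
  refine Finset.sum_congr rfl fun e _ => ?_
  rw [sub_right_comm]
  ring

omit hphi in
-- The full convolution of Φ_{pq} with `partCoeff` is zero. Its part e ≥ d uses arguments at most K,
-- where `partCoeff` agrees with the truncated Φ_{pqr}; hence the coefficient is minus the part e <
-- d.
theorem coeff_mul_truncLT_boundary {K d : ℕ} (hd : 1 ≤ d) (hd' : d ≤ primePhi p q) :
    (cyclotomic (p * q) ℤ * truncLT (K + 1) (cyclotomic (p * q * r) ℤ)).coeff (K + d) =
      boundaryCoeff p q r K d := by
  have h := sum_phiCoeff_partCoeff (r := r) hp hq hpq K (K + d : ℕ)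
  rw [← Finset.sum_range_add_sum_Ico _ (show d ≤ primePhi p q + 1 by omega)] at h
  rw [boundaryCoeff, ← eq_neg_of_add_eq_zero_right h, coeff_mul_eq_sum_range,
    natDegree_cyclotomic_mul hp hq hpq, ← Finset.sum_range_add_sum_Ico _
      (show d ≤ primePhi p q + 1 by omega), Finset.sum_eq_zero, zero_add]
  · refine Finset.sum_congr rfl fun e he => ?_
    rw [mem_Ico] at he
    rw [phiCoeff]
    congr 1
    split_ifs with het
    · rw [coeff_truncLT, if_pos (by omega), ← Nat.cast_sub het,
        ← triCoeff_eq_partCoeff hp hq hr hpq hqr (by omega) (by omega)]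
      rfl
    · rw [partCoeff_neg_eq_zero hp hr hpq (by omega) (by omega)]
  · intro e he
    rw [mem_range] at he
    rw [if_pos (by omega), coeff_truncLT, if_neg (by omega), mul_zero]

omit hphi in
theorem coeff_mul_truncLT_of_le {K t : ℕ} (ht : t ≤ K) :
    (cyclotomic (p * q) ℤ * truncLT (K + 1) (cyclotomic (p * q * r) ℤ)).coeff t =
      if r ∣ t then phiCoeff p q (t / r) else 0 := by
  rw [phiCoeff, ← coeff_expand hr.pos, cyclotomic_expand_eq_cyclotomic_mul hr
    (not_dvd_mul_of_lt hp hq hr hpq hqr), mul_comm (cyclotomic (p * q * r) ℤ), coeff_mul,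
    coeff_mul]
  refine Finset.sum_congr rfl fun x hx => ?_
  rw [HasAntidiagonal.mem_antidiagonal] at hx
  rw [coeff_truncLT, if_pos (by omega)]

omit hphi in
-- The truncation is multiplied by Φ_{pq}(X) before dividing by Φ_{pq}(X^r). Degrees up to K give
-- the first summand, the overshoot of length φ gives the second.
theorem triConv_eq (K : ℕ) (h : ℤ) : triConv p q r K h =
    (if (r : ℤ) ∣ h then
      ∑ l ∈ range (K / r + 1), phiCoeff p q l * invCoeff p q (h / r - l) else 0) +
    ∑ d ∈ range (primePhi p q), boundaryCoeff p q r K (d + 1) *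
      (if (r : ℤ) ∣ h - (K + (d + 1) : ℕ) then
        invCoeff p q ((h - (K + (d + 1) : ℕ)) / r) else 0) := by
  have hr0 : (r : ℤ) ≠ 0 := by exact_mod_cast hr.ne_zero
  set w : ℕ → ℤ := fun t =>
    if (r : ℤ) ∣ h - t then invCoeff p q ((h - t) / r) else 0 with hw
  have h1 : triConv p q r K h =
      polyEval w (truncLT (K + 1) (cyclotomic (p * q * r) ℤ) * cyclotomic (p * q) ℤ) := by
    rw [polyEval_truncLT_mul, triConv]
    refine Finset.sum_congr rfl fun j _ => ?_
    rw [triInv_eq hp hq hpq, polyEval_apply_of_lt _ _ (Nat.lt_succ_self _),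
      natDegree_cyclotomic_mul hp hq hpq]
    rw [triCoeff]
    congr 1
    refine Finset.sum_congr rfl fun e _ => ?_
    simp only [hw, Nat.cast_add, sub_sub]
    rfl
  have hdeg : (truncLT (K + 1) (cyclotomic (p * q * r) ℤ)).natDegree ≤ K := by
    rw [natDegree_le_iff_coeff_eq_zero]
    intro k hk
    rw [coeff_truncLT, if_neg (by omega)]
  rw [h1, polyEval_apply_of_lt w _ (N := K + 1 + primePhi p q), Finset.sum_range_add]
  · congr 1
    · trans ∑ t ∈ range (K + 1), if r ∣ t then phiCoeff p q (t / r) * w t else 0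
      · refine Finset.sum_congr rfl fun t ht => ?_
        rw [mem_range] at ht
        rw [mul_comm (truncLT _ _), coeff_mul_truncLT_of_le hp hq hr hpq hqr (by omega)]
        split_ifs <;> simp
      · rw [sum_range_dvd hr.pos]
        have h2 : ∀ l : ℕ, (r : ℤ) ∣ h - (r * l : ℕ) ↔ (r : ℤ) ∣ h := by
          intro l
          rw [Nat.cast_mul]
          exact dvd_sub_left (dvd_mul_right _ _)
        simp only [hw, h2]
        split_ifs with hd
        · refine Finset.sum_congr rfl fun l _ => ?_
          rw [Nat.mul_div_cancel_left _ hr.pos, Nat.cast_mul, Int.sub_ediv_of_dvd _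
            (dvd_mul_right _ _), Int.mul_ediv_cancel_left _ hr0]
        · simp
    · refine Finset.sum_congr rfl fun d hd => ?_
      rw [mem_range] at hd
      rw [mul_comm (truncLT _ _), add_assoc, add_comm 1 d,
        coeff_mul_truncLT_boundary hp hq hr hpq hqr (by omega) (by omega)]
  · have := natDegree_mul_le (p := truncLT (K + 1) (cyclotomic (p * q * r) ℤ))
      (q := cyclotomic (p * q) ℤ)
    rw [natDegree_cyclotomic_mul hp hq hpq] at this
    omega

end

/-! ### Values of `triConv` in terms of `truncProd` -/

section
variable {p q r : ℕ} (hp : p.Prime) (hq : q.Prime) (hr : r.Prime) (hpq : p < q) (hqr : q < r)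
  (hphi : primePhi p q < r)
include hp hq hr hpq hqr hphi

omit hp hq hr hpq hqr hphi in
theorem partCoeff_congr {η : ℤ} (hη : ((p * q : ℕ) : ℤ) ∣ r - η) (K : ℕ) (x : ℤ) :
    partCoeff p q r K x =
      ∑ l ∈ range (K / r + 1), phiCoeff p q l * invCoeff p q (x - η * l) := by
  refine Finset.sum_congr rfl fun l _ => ?_
  congr 1
  apply invCoeff_congr
  rw [show x - r * l - (x - η * l) = (r - η) * -l by ring]
  exact Dvd.dvd.mul_right hη _

omit hp hq hr hpq hqr hphi in
theorem boundaryCoeff_of_one (h1 : ((p * q : ℕ) : ℤ) ∣ r - 1) (K d : ℕ) :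
    boundaryCoeff p q r K d = -truncProd p q d (K / r + 1) (K + d : ℕ) := by
  simp only [boundaryCoeff, truncProd, partCoeff_congr h1, one_mul]

omit hr hqr hphi in
theorem boundaryCoeff_of_neg_one (h1 : ((p * q : ℕ) : ℤ) ∣ r + 1) (K d : ℕ) :
    boundaryCoeff p q r K d =
      truncProd p q d (primePhi p q + 1 - (K / r + 1)) ((K + d : ℕ) + primePhi p q) := by
  rw [← neg_neg (truncProd _ _ _ _ _), ← sum_sum_add_eq_neg_truncProd hp hq hpq, boundaryCoeff]
  simp only [partCoeff_congr (η := -1) (by rwa [sub_neg_eq_add]), neg_mul, one_mul, sub_neg_eq_add]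

omit hp hq hpq hqr in
theorem eq_mul_of_dvd_add {K d : ℕ} (hd : 1 ≤ d) (hd' : d ≤ primePhi p q) (hdvd : r ∣ K + d) :
    K + d = r * (K / r + 1) := by
  obtain ⟨c, hc⟩ := hdvd
  have h1 := Nat.div_add_mod K r
  have h2 := Nat.mod_lt K hr.pos
  rw [hc]
  congr 1
  have h3 : c < K / r + 2 := by
    apply Nat.lt_of_mul_lt_mul_left (a := r)
    rw [← hc, mul_add]; omega
  have h4 : K / r < c := by
    apply Nat.lt_of_mul_lt_mul_left (a := r)
    rw [← hc]; omega
  omega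

omit hqr in
-- With J = K/r, the inner convolutions lie where a truncation is as good as the full series, so
-- they are Kronecker deltas. For r ≡ 1 the exception is e = 0, where the missing term l = J+1
-- leaves a defect, which e = J+1 cancels if that index is in range. For r ≡ -1 only e = φ-(J+1) can
-- contribute.
theorem boundaryCoeff_of_dvd (hη : ((p * q : ℕ) : ℤ) ∣ r - 1 ∨ ((p * q : ℕ) : ℤ) ∣ r + 1) {K d : ℕ}
    (hd : 1 ≤ d) (hd' : d ≤ primePhi p q) (hdvd : r ∣ K + d) :
    boundaryCoeff p q r K d = 0 ∨ boundaryCoeff p q r K d = phiCoeff p q (K / r + 1) := by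
  have ht := eq_mul_of_dvd_add hr hphi hd hd' hdvd
  rw [boundaryCoeff]
  obtain ⟨J, hJ⟩ : ∃ J, K / r = J := ⟨_, rfl⟩
  rw [hJ] at ht ⊢
  rw [ht]
  rcases hη with h1 | h1
  · have hin : ∀ e ∈ range d, phiCoeff p q e * partCoeff p q r K ((r * (J + 1) : ℕ) - e) =
        (if e = 0 then -phiCoeff p q (J + 1) else 0) +
          if e = J + 1 then phiCoeff p q (J + 1) else 0 := by
      intro e he
      rw [mem_range] at he
      rw [partCoeff_congr h1, hJ]
      have h2 : ∀ l : ℕ, invCoeff p q ((r * (J + 1) : ℕ) - e - 1 * l) =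
          invCoeff p q ((J + 1 : ℕ) - e - l) := by
        intro l
        apply invCoeff_congr
        rw [show ((r * (J + 1) : ℕ) : ℤ) - e - 1 * l - ((J + 1 : ℕ) - e - l) =
          (r - 1) * (J + 1) by push_cast; ring]
        exact Dvd.dvd.mul_right h1 _
      simp only [h2]
      rcases Nat.eq_zero_or_pos e with rfl | he0
      · have h3 := sum_phiCoeff_invCoeff_of_le hp hq hpq (J := J + 1) (v := (J + 1 : ℕ)) le_rfl
          (by omega)
        rw [Finset.sum_range_succ, sub_self, invCoeff_zero hp.pos hpq, if_neg (by omega)] at h3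
        rw [if_pos rfl, if_neg (by omega), phiCoeff_zero hp hpq]
        simp only [Nat.cast_zero, sub_zero]
        linarith
      · rw [sum_phiCoeff_invCoeff_of_le hp hq hpq (by omega) (by omega), if_neg (show ¬ e = 0 by omega)]
        split_ifs with h4 h5 h5
        · rw [h5]; ring
        · omega
        · omega
        · ring
    rw [Finset.sum_congr rfl hin, Finset.sum_add_distrib, Finset.sum_ite_eq' , Finset.sum_ite_eq',
      if_pos (by simp; omega)]
    split_ifs
    · left; ring
    · right; ring
  · have hin : ∀ e ∈ range d, phiCoeff p q e * partCoeff p q r K ((r * (J + 1) : ℕ) - e) =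
        if J + 1 ≤ primePhi p q ∧ e = primePhi p q - (J + 1) then -phiCoeff p q (J + 1) else 0 := by
      intro e he
      rw [mem_range] at he
      rw [partCoeff_congr (η := -1) (by rwa [sub_neg_eq_add]), hJ]
      have h2 : ∀ l : ℕ, invCoeff p q ((r * (J + 1) : ℕ) - e - -1 * l) =
          -invCoeff p q ((J + 1 : ℕ) + e - primePhi p q - l) := by
        intro l
        rw [← invCoeff_symm hp.two_le hpq]
        apply invCoeff_congr
        rw [show ((r * (J + 1) : ℕ) : ℤ) - e - -1 * l -
          (-primePhi p q - ((J + 1 : ℕ) + e - primePhi p q - l)) =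
          (r + 1) * (J + 1) by push_cast; ring]
        exact Dvd.dvd.mul_right h1 _
      simp only [h2, mul_neg, Finset.sum_neg_distrib]
      rw [sum_phiCoeff_invCoeff_of_le hp hq hpq (by omega) (by omega)]
      split_ifs with h4 h5 h5
      · rw [h5.2, phiCoeff_symm hp hq hpq h5.1]; ring
      · omega
      · omega
      · ring
    rw [Finset.sum_congr rfl hin]
    by_cases h3 : J + 1 ≤ primePhi p q
    · simp only [h3, true_and]
      rw [Finset.sum_ite_eq']
      split_ifs
      · right; ring
      · left; ring
    · left
      simp [h3]

theorem abs_triConv_le (hη : ((p * q : ℕ) : ℤ) ∣ r - 1 ∨ ((p * q : ℕ) : ℤ) ∣ r + 1)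
    (hflat : ∀ i J u, |truncProd p q i J u| ≤ 1) (K : ℕ) (h : ℤ) :
    |triConv p q r K h| ≤ 1 := by
  have hr0 : (r : ℤ) ≠ 0 := by exact_mod_cast hr.ne_zero
  have hS : ∀ J x, |∑ l ∈ range J, phiCoeff p q l * invCoeff p q (x - l)| ≤ 1 := by
    intro J x
    rw [← truncProd_one hp hpq]
    exact hflat 1 J x
  have hB : ∀ d, |boundaryCoeff p q r K d| ≤ 1 := by
    intro d
    rcases hη with h1 | h1
    · rw [boundaryCoeff_of_one h1, abs_neg]
      exact hflat _ _ _
    · rw [boundaryCoeff_of_neg_one hp hq hpq h1]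
      exact hflat _ _ _
  rw [triConv_eq hp hq hr hpq hqr]
  -- Since φ < r, at most one boundary index lies in the class of h mod r.
  by_cases hex : ∃ d < primePhi p q, (r : ℤ) ∣ h - (K + (d + 1) : ℕ)
  · obtain ⟨d, hd, hdvd⟩ := hex
    rw [Finset.sum_eq_single (s := range (primePhi p q)) d, if_pos hdvd]
    · split_ifs with hrh
      · have h2 : (r : ℤ) ∣ (K + (d + 1) : ℕ) := (dvd_sub_right hrh).1 hdvd
        have h3 : r ∣ K + (d + 1) := by exact_mod_cast h2
        have h4 := eq_mul_of_dvd_add hr hphi (by omega) (by omega) h3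
        rcases boundaryCoeff_of_dvd hp hq hr hpq hphi hη (d := d + 1) (by omega) (by omega) h3
          with h5 | h5
        · rw [h5, zero_mul, add_zero]
          exact hS _ _
        -- The boundary term is exactly the next term of the main sum, so the two merge into a
        -- truncation longer by one.
        · rw [h5, h4, Int.sub_ediv_of_dvd _ (by rw [Nat.cast_mul]; exact dvd_mul_right _ _),
            Nat.cast_mul r, Int.mul_ediv_cancel_left _ hr0, ← Finset.sum_range_succ
              (fun l : ℕ => phiCoeff p q l * invCoeff p q (h / r - l))]
          exact hS _ _
      · rw [zero_add, abs_mul]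
        exact mul_le_one₀ (hB _) (abs_nonneg _) (abs_invCoeff_le _ _ _)
    · intro d' hd' hne
      rw [mem_range] at hd'
      rw [if_neg, mul_zero]
      intro hd2
      apply hne
      have h2 := dvd_sub hdvd hd2
      rw [show h - ((K + (d + 1) : ℕ) : ℤ) - (h - ((K + (d' + 1) : ℕ) : ℤ)) = (d' : ℤ) - d by
        push_cast; ring] at h2
      have h3 := Int.eq_zero_of_abs_lt_dvd h2 (by rw [abs_lt]; omega)
      omega
    · intro h2
      simp at h2
      omega
  · rw [Finset.sum_eq_zero (s := range (primePhi p q)), add_zero]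
    · split_ifs
      · exact hS _ _
      · simp
    · intro d hd
      rw [mem_range] at hd
      rw [if_neg, mul_zero]
      exact fun h2 => hex ⟨d, hd, h2⟩

theorem triConv_of_not_dvd {K d : ℕ} (hd : 1 ≤ d) (hd' : d ≤ primePhi p q) (hnd : ¬ r ∣ K + d) :
    triConv p q r K (K + d : ℕ) = boundaryCoeff p q r K d := by
  rw [triConv_eq hp hq hr hpq hqr, if_neg (by exact_mod_cast hnd), zero_add,
    Finset.sum_eq_single (d - 1)]
  · rw [Nat.sub_add_cancel hd, sub_self, if_pos (dvd_zero _), Int.zero_ediv,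
      invCoeff_zero hp.pos hpq, mul_one]
  · intro d' hd2 hne
    rw [mem_range] at hd2
    rw [if_neg, mul_zero]
    intro h2
    rw [show ((K + d : ℕ) : ℤ) - (K + (d' + 1) : ℕ) = (d : ℤ) - (d' + 1) by push_cast; ring] at h2
    have h3 := Int.eq_zero_of_abs_lt_dvd h2 (by rw [abs_lt]; omega)
    omega
  · intro h2
    simp at h2
    omega

/-- A product of truncations occurs, up to sign, as a boundary coefficient. -/
theorem exists_triConv_eq (hη : ((p * q : ℕ) : ℤ) ∣ r - 1 ∨ ((p * q : ℕ) : ℤ) ∣ r + 1)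
    {i J u : ℕ} (hi : 1 ≤ i) (hi' : i ≤ primePhi p q) (hJ : 1 ≤ J) (hJ' : J ≤ primePhi p q)
    (hu : i + J ≤ u) (hu' : u < p * q) :
    ∃ K, |triConv p q r K (K + i : ℕ)| = |truncProd p q i J u| := by
  have hphi0 := phi_add hp.two_le hpq
  have hp2 := hp.two_le
  have hr2 := hr.two_le
  have key : ∀ J' k, 1 ≤ J' → k < r → ¬ r ∣ k + i → ∃ K, K = r * (J' - 1) + k ∧ K / r + 1 = J' ∧
      triConv p q r K (K + i : ℕ) = boundaryCoeff p q r K i := by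
    intro J' k hJ1 hk hki
    refine ⟨r * (J' - 1) + k, rfl, ?_, triConv_of_not_dvd hp hq hr hpq hqr hphi hi hi' ?_⟩
    · rw [Nat.mul_add_div hr.pos, Nat.div_eq_of_lt hk]
      omega
    · rw [add_assoc]
      intro h
      exact hki ((Nat.dvd_add_right (dvd_mul_right _ _)).1 h)
  rcases hη with h1 | h1
  · have hrn : p * q < r := by
      have := Int.le_of_dvd (by omega) h1
      omega
    -- With r ≡ 1, K + i ≡ (J-1) + (u+1-i-J) + i = u mod pq.
    obtain ⟨K, hK, hK2, hK3⟩ := key J (u + 1 - i - J) hJ (by omega) (by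
      intro h
      have := Nat.le_of_dvd (by omega) h
      omega)
    refine ⟨K, ?_⟩
    rw [hK3, boundaryCoeff_of_one h1, hK2, abs_neg]
    congr 1
    rw [truncProd, truncProd]
    refine Finset.sum_congr rfl fun e _ => ?_
    congr 1
    refine Finset.sum_congr rfl fun l _ => ?_
    congr 1
    apply invCoeff_congr
    obtain ⟨c, hc⟩ := h1
    refine ⟨c * (J - 1), ?_⟩
    rw [hK]
    push_cast [show i ≤ u + 1 by omega, show J ≤ u + 1 - i by omega, hJ]
    push_cast at hc
    linear_combination (J - 1 : ℤ) * hc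
  · have hrn : p * q ≤ r + 1 := by
      have := Int.le_of_dvd (by omega) h1
      omega
    -- With r ≡ -1 the boundary coefficient involves the complementary length, hence φ+1-J here;
    -- then K + i + φ ≡ -(φ-J) + (u-J) + φ = u mod pq.
    obtain ⟨K, hK, hK2, hK3⟩ := key (primePhi p q + 1 - J) (u - i - J) (by omega) (by omega) (by
      intro h
      have := Nat.le_of_dvd (by omega) h
      omega)
    refine ⟨K, ?_⟩
    rw [hK3, boundaryCoeff_of_neg_one hp hq hpq h1, hK2, Nat.sub_sub_self (by omega)]
    congr 1
    rw [truncProd, truncProd]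
    refine Finset.sum_congr rfl fun e _ => ?_
    congr 1
    refine Finset.sum_congr rfl fun l _ => ?_
    congr 1
    apply invCoeff_congr
    obtain ⟨c, hc⟩ := h1
    refine ⟨c * (primePhi p q - J), ?_⟩
    rw [hK, show primePhi p q + 1 - J - 1 = primePhi p q - J by omega]
    push_cast [show i ≤ u by omega, show J ≤ u - i by omega, hJ']
    push_cast at hc
    linear_combination (primePhi p q - J : ℤ) * hc

end

theorem Polynomial.isFlat_iff_of_coeff_zero {f : ℤ[X]} (h0 : f.coeff 0 = 1) :
    f.IsFlat ↔ ∀ k, |f.coeff k| ≤ 1 := by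
  have hn : ∀ k, ‖f.coeff k‖ = ((|f.coeff k| : ℤ) : ℝ) := fun k => by
    rw [Int.norm_eq_abs, Int.cast_abs]
  constructor
  · intro h k
    have h1 := f.le_supNorm k
    rw [h, hn] at h1
    exact_mod_cast h1
  · intro h
    refine le_antisymm ?_ ?_
    · obtain ⟨k, hk⟩ := f.exists_eq_supNorm
      rw [hk, hn]
      exact_mod_cast h k
    · have h1 := f.le_supNorm 0
      rwa [h0, norm_one] at h1

/-! ### Coefficients of Φ_{pqrs} -/

section
variable {p q r s : ℕ} (hp : p.Prime) (hq : q.Prime) (hr : r.Prime) (hs : s.Prime)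
  (hpq : p < q) (hqr : q < r) (hrs : r < s) (hphi : primePhi p q < r)
include hp hq hr hs hpq hqr hrs hphi

theorem coeff_cyclotomic_four (k : ℕ) : (cyclotomic (p * q * r * s) ℤ).coeff k =
    ∑ j ∈ range (k / s + 1), triCoeff p q r j * triInv p q r (k - s * j) := by
  refine coeff_cyclotomic_mul_prime hs ?_ _ (triInv_spec hp hq hr hpq hqr hphi) k
  intro h
  rcases (hs.dvd_mul).1 h with h | h
  · exact not_dvd_mul_of_lt hp hq hs hpq (hqr.trans hrs) h
  · exact absurd (Nat.le_of_dvd hr.pos h) (by omega)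

theorem coeff_cyclotomic_four_of_one (h1 : ((p * q * r : ℕ) : ℤ) ∣ s - 1) (k : ℕ) :
    (cyclotomic (p * q * r * s) ℤ).coeff k = triConv p q r (k / s) k := by
  rw [coeff_cyclotomic_four hp hq hr hs hpq hqr hrs hphi, triConv]
  refine Finset.sum_congr rfl fun j _ => ?_
  congr 1
  apply triInv_congr hp hq hr hpq
  rw [show (k - s * j : ℤ) - (k - j) = (s - 1) * -j by ring]
  exact Dvd.dvd.mul_right h1 _

/-- Now k - sj ≡ k + j; the antisymmetry of `triInv` about -deg Φ_{pqr} = -φ(r-1) restores a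
difference in j. -/
theorem coeff_cyclotomic_four_of_neg_one (h1 : ((p * q * r : ℕ) : ℤ) ∣ s + 1) (k : ℕ) :
    (cyclotomic (p * q * r * s) ℤ).coeff k =
      -triConv p q r (k / s) (-(primePhi p q * (r - 1)) - k) := by
  rw [coeff_cyclotomic_four hp hq hr hs hpq hqr hrs hphi, triConv, ← Finset.sum_neg_distrib]
  refine Finset.sum_congr rfl fun j _ => ?_
  refine Eq.trans ?_ (mul_neg _ _)
  rw [← triInv_symm hp hq hr hpq]
  congr 1
  apply triInv_congr hp hq hr hpq
  rw [show (k - s * j : ℤ) - (-(primePhi p q * (r - 1)) -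
    (-(primePhi p q * (r - 1)) - k - j)) = (s + 1) * -j by ring]
  exact Dvd.dvd.mul_right h1 _

theorem abs_coeff_cyclotomic_four_le
    (hη : ((p * q : ℕ) : ℤ) ∣ r - 1 ∨ ((p * q : ℕ) : ℤ) ∣ r + 1)
    (hσ : ((p * q * r : ℕ) : ℤ) ∣ s - 1 ∨ ((p * q * r : ℕ) : ℤ) ∣ s + 1)
    (hflat : ∀ i J u, |truncProd p q i J u| ≤ 1) (k : ℕ) :
    |(cyclotomic (p * q * r * s) ℤ).coeff k| ≤ 1 := by
  rcases hσ with h1 | h1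
  · rw [coeff_cyclotomic_four_of_one hp hq hr hs hpq hqr hrs hphi h1]
    exact abs_triConv_le hp hq hr hpq hqr hphi hη hflat _ _
  · rw [coeff_cyclotomic_four_of_neg_one hp hq hr hs hpq hqr hrs hphi h1, abs_neg]
    exact abs_triConv_le hp hq hr hpq hqr hphi hη hflat _ _

theorem exists_abs_coeff_cyclotomic_four_eq
    (hη : ((p * q : ℕ) : ℤ) ∣ r - 1 ∨ ((p * q : ℕ) : ℤ) ∣ r + 1)
    (hσ : ((p * q * r : ℕ) : ℤ) ∣ s - 1 ∨ ((p * q * r : ℕ) : ℤ) ∣ s + 1)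
    {i J u : ℕ} (hi : 1 ≤ i) (hi' : i ≤ primePhi p q) (hJ : 1 ≤ J) (hJ' : J ≤ primePhi p q)
    (hu : i + J ≤ u) (hu' : u < p * q) :
    ∃ k, |(cyclotomic (p * q * r * s) ℤ).coeff k| = |truncProd p q i J u| := by
  obtain ⟨K, hK⟩ := exists_triConv_eq hp hq hr hpq hqr hphi hη hi hi' hJ hJ' hu hu'
  have hr2 := hr.two_le
  rw [← hK]
  rcases hσ with h1 | h1
  · refine ⟨s * K + i, ?_⟩
    rw [coeff_cyclotomic_four_of_one hp hq hr hs hpq hqr hrs hphi h1, Nat.mul_add_div hs.pos,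
      Nat.div_eq_of_lt (by omega), add_zero]
    congr 1
    refine Finset.sum_congr rfl fun j _ => ?_
    congr 1
    apply triInv_congr hp hq hr hpq
    rw [show ((s * K + i : ℕ) - j : ℤ) - ((K + i : ℕ) - j) = (s - 1) * K by push_cast; ring]
    exact Dvd.dvd.mul_right h1 _
  · have hphi0 := phi_add hp.two_le hpq
    have hp2 := hp.two_le
    have hsn : p * q * r ≤ s + 1 := by
      have := Int.le_of_dvd (by omega) h1
      omega
    have hlt : i + primePhi p q * (r - 1) < p * q * r := by
      obtain ⟨r', rfl⟩ : ∃ r', r = r' + 1 := ⟨r - 1, by omega⟩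
      have : primePhi p q * (r' + 1) < p * q * (r' + 1) :=
        Nat.mul_lt_mul_of_pos_right (by omega) (by omega)
      rw [Nat.add_sub_cancel]
      rw [mul_add] at this
      omega
    have hpos : 1 ≤ primePhi p q * (r - 1) := Nat.mul_pos (by omega) (by omega)
    -- This index k satisfies -φ(r-1) - k ≡ K + i mod pqr, and its remainder after sK is below s
    -- because s ≥ pqr - 1.
    refine ⟨s * K + (p * q * r - (i + primePhi p q * (r - 1))), ?_⟩
    rw [coeff_cyclotomic_four_of_neg_one hp hq hr hs hpq hqr hrs hphi h1, Nat.mul_add_div hs.pos,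
      Nat.div_eq_of_lt (by omega), add_zero, abs_neg]
    congr 1
    refine Finset.sum_congr rfl fun j _ => ?_
    congr 1
    apply triInv_congr hp hq hr hpq
    obtain ⟨c, hc⟩ := h1
    refine ⟨-c * K - 1, ?_⟩
    push_cast [hlt.le, show 1 ≤ r by omega]
    push_cast at hc
    linear_combination -K * hc

end

/-! ### Low-degree coefficients of Φ_{pq} -/

section
variable {p q : ℕ}

theorem invCoeff_eq_one {v : ℤ} (hpq : p < q) (hn : q + p ≤ p * q) (h0 : 0 ≤ v) (h : v < p) :
    invCoeff p q v = 1 := by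
  rw [invCoeff_of_lt h0 (by omega), if_pos h, if_neg (by omega), sub_zero]

theorem invCoeff_eq_neg_one {v : ℤ} (hpq : p < q) (hn : q + p ≤ p * q) (h0 : q ≤ v)
    (h : v < q + p) : invCoeff p q v = -1 := by
  rw [invCoeff_of_lt (by omega) (by omega), if_neg (by omega), if_pos ⟨h0, h⟩, zero_sub]

theorem invCoeff_eq_zero_mid {v : ℤ} (hn : q + p ≤ p * q) (h0 : p ≤ v) (h : v < q) :
    invCoeff p q v = 0 := by
  rw [invCoeff_of_lt (by omega) (by omega), if_neg (by omega), if_neg (by omega), zero_sub,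
    neg_zero]

theorem invCoeff_eq_zero_high {v : ℤ} (h0 : q + p ≤ v) (h : v < (p * q : ℕ)) :
    invCoeff p q v = 0 := by
  rw [invCoeff_of_lt (by omega) (by omega), if_neg (by omega), if_neg (by omega), zero_sub,
    neg_zero]

variable (hp : p.Prime) (hq : q.Prime) (hpq : p < q)
include hp hq hpq

/-- Read off from Φ_{pq}(1 - X^p)(1 - X^q) = (1 - X)(1 - X^{pq}) in degrees below p+q and pq. -/
theorem phiCoeff_rec {k : ℕ} (hk : k < p + q) (hk' : k < p * q) :
    phiCoeff p q k = (if p ≤ k then phiCoeff p q (k - p) else 0) +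
      (if q ≤ k then phiCoeff p q (k - q) else 0) +
      ((if k = 0 then 1 else 0) - (if k = 1 then 1 else 0)) := by
  have h1 : cyclotomic (p * q) ℤ * (1 - X ^ p - X ^ q + X ^ (p + q)) =
      1 - X - X ^ (p * q) + X ^ (p * q + 1) := by
    have h2 := cyclotomic_mul_invNum hp hq hpq
    have h3 := geom_sum_mul_neg (X : ℤ[X]) p
    rw [invNum] at h2
    linear_combination (1 - X) * h2 - cyclotomic (p * q) ℤ * (1 - X ^ q) * h3
  have h4 := congrArg (fun f => coeff f k) h1
  simp only [mul_add, mul_sub, mul_one, coeff_add, coeff_sub, coeff_mul_X_pow', coeff_X_pow,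
    coeff_one, coeff_X] at h4
  rw [if_neg (show ¬ p + q ≤ k by omega), if_neg (show ¬ k = p * q by omega),
    if_neg (show ¬ k = p * q + 1 by omega)] at h4
  simp only [eq_comm (a := 1) (b := k)] at h4
  simp only [phiCoeff]
  linarith

theorem phiCoeff_of_lt_first {k : ℕ} (hk : k < p) :
    phiCoeff p q k = (if k = 0 then 1 else 0) - (if k = 1 then 1 else 0) := by
  have hn := add_lt_mul_of_primes hp.two_le hpq
  rw [phiCoeff_rec hp hq hpq (by omega) (by omega), if_neg (by omega), if_neg (by omega)]
  simp

/-- Below degree q, Φ_{pq} looks like (1 - X)/(1 - X^p). -/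
theorem phiCoeff_of_lt_second {k : ℕ} (hk : k < q) :
    phiCoeff p q k = (if p ∣ k then 1 else 0) - (if 1 ≤ k ∧ p ∣ k - 1 then 1 else 0) := by
  have hn := add_lt_mul_of_primes hp.two_le hpq
  have hp2 := hp.two_le
  induction k using Nat.strong_induction_on with
  | _ k ih =>
    by_cases hkp : k < p
    · rw [phiCoeff_of_lt_first hp hq hpq hkp]
      have h1 : p ∣ k ↔ k = 0 := ⟨fun h => Nat.eq_zero_of_dvd_of_lt h hkp, fun h => h ▸ dvd_zero _⟩
      have h2 : 1 ≤ k ∧ p ∣ k - 1 ↔ k = 1 :=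
        ⟨fun h => by have := Nat.eq_zero_of_dvd_of_lt h.2 (by omega); omega, fun h => by simp [h]⟩
      simp only [h1, h2]
    · rw [phiCoeff_rec hp hq hpq (by omega) (by omega), if_pos (by omega), if_neg (by omega),
        if_neg (by omega), if_neg (by omega), ih (k - p) (by omega) (by omega)]
      have h1 : p ∣ k - p ↔ p ∣ k := Nat.dvd_sub_iff_left (by omega) dvd_rfl
      have h2 : 1 ≤ k - p ∧ p ∣ k - p - 1 ↔ 1 ≤ k ∧ p ∣ k - 1 := by
        constructor
        · rintro ⟨h3, h4⟩
          rw [show k - p - 1 = k - 1 - p by omega] at h4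
          exact ⟨by omega, (Nat.dvd_sub_iff_left (by omega) dvd_rfl).1 h4⟩
        · rintro ⟨h3, h4⟩
          have h5 : k ≠ p := by
            rintro rfl
            have h6 := (Nat.dvd_sub_iff_right (by omega) (dvd_refl k)).1 h4
            have := Nat.le_of_dvd one_pos h6
            omega
          rw [show k - p - 1 = k - 1 - p by omega]
          exact ⟨by omega, (Nat.dvd_sub_iff_left (by omega) dvd_rfl).2 h4⟩
      simp only [h1, h2]
      ring

theorem sum_phiCoeff_succ_prime (hpq2 : p + 1 < q) (F : ℕ → ℤ) :
    ∑ e ∈ range (p + 1), phiCoeff p q e * F e = F 0 - F 1 + F p := by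
  have hp2 := hp.two_le
  have h1 : ∀ e ∈ range (p + 1), phiCoeff p q e * F e = (if e = 0 then F e else 0) -
      (if e = 1 then F e else 0) + (if e = p then F e else 0) := by
    intro e he
    rw [mem_range] at he
    rcases Nat.lt_or_ge e p with h | h
    · rw [phiCoeff_of_lt_first hp hq hpq h, if_neg (show ¬ e = p by omega)]
      split_ifs <;> omega
    · obtain rfl : e = p := by omega
      have h2 : ¬ (1 ≤ e ∧ e ∣ e - 1) := fun h2 => by
        have := Nat.le_of_dvd (by omega) h2.2
        omega
      rw [phiCoeff_of_lt_second hp hq hpq (by omega), if_pos dvd_rfl, if_neg h2,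
        if_neg (by omega), if_neg (by omega), if_pos rfl]
      ring
  rw [Finset.sum_congr rfl h1]
  simp only [Finset.sum_add_distrib, Finset.sum_sub_distrib, Finset.sum_ite_eq', mem_range]
  rw [if_pos (by omega), if_pos (by omega), if_pos (by omega)]

/-- Up to degree 2p, Φ_{pq} looks like (1 - X)(1 + X^p + X^q + X^{2p}). -/
theorem phiCoeff_of_lt_two_mul (hq2 : p + 1 < q) (hq3 : q + 1 < 2 * p) {k : ℕ} (hk : k ≤ 2 * p) :
    phiCoeff p q k = (if k = 0 then 1 else 0) - (if k = 1 then 1 else 0) +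
      (if k = p then 1 else 0) - (if k = p + 1 then 1 else 0) +
      (if k = q then 1 else 0) - (if k = q + 1 then 1 else 0) + (if k = 2 * p then 1 else 0) := by
  have hn := add_lt_mul_of_primes hp.two_le hpq
  have h0 : phiCoeff p q p = 1 := by
    rw [phiCoeff_rec hp hq hpq (by omega) (by omega), if_pos le_rfl, if_neg (by omega),
      if_neg (by omega), if_neg (by omega), Nat.sub_self, phiCoeff_zero hp hpq]
    simp
  rcases Nat.lt_or_ge k p with h | h
  · rw [phiCoeff_of_lt_first hp hq hpq h]
    split_ifs <;> omega
  have h1 : phiCoeff p q (k - p) = (if k = p then 1 else 0) - (if k = p + 1 then 1 else 0) +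
      (if k = 2 * p then 1 else 0) := by
    rcases Nat.lt_or_ge k (2 * p) with h2 | h2
    · rw [phiCoeff_of_lt_first hp hq hpq (by omega)]
      split_ifs <;> omega
    · rw [show k - p = p by omega, h0]
      split_ifs <;> omega
  rw [phiCoeff_rec hp hq hpq (by omega) (by omega), if_pos h, h1]
  rcases Nat.lt_or_ge k q with h2 | h2
  · rw [if_neg (show ¬ q ≤ k by omega)]
    split_ifs <;> omega
  · rw [if_pos h2, phiCoeff_of_lt_first hp hq hpq (by omega)]
    split_ifs <;> omega

theorem sum_phiCoeff_two_mul (hq2 : p + 1 < q) (hq3 : q + 1 < 2 * p) (F : ℕ → ℤ) :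
    ∑ e ∈ range (2 * p + 1), phiCoeff p q e * F e =
      F 0 - F 1 + F p - F (p + 1) + F q - F (q + 1) + F (2 * p) := by
  have hp2 := hp.two_le
  rw [Finset.sum_congr rfl fun e he => congrArg (· * F e)
    (phiCoeff_of_lt_two_mul hp hq hpq hq2 hq3 (k := e) (by rw [mem_range] at he; omega))]
  simp only [add_mul, sub_mul, ite_mul, one_mul, zero_mul, Finset.sum_add_distrib,
    Finset.sum_sub_distrib, Finset.sum_ite_eq', mem_range]
  simp (disch := omega) only [if_pos]

theorem sum_phiCoeff_second (hq2 : p + 1 < q) (hq3 : q + 1 < 2 * p) (F : ℕ → ℤ) :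
    ∑ e ∈ range (q + 1), phiCoeff p q e * F e = F 0 - F 1 + F p - F (p + 1) + F q := by
  have hp2 := hp.two_le
  rw [Finset.sum_congr rfl fun e he => congrArg (· * F e)
    (phiCoeff_of_lt_two_mul hp hq hpq hq2 hq3 (k := e) (by rw [mem_range] at he; omega))]
  simp only [add_mul, sub_mul, ite_mul, one_mul, zero_mul, Finset.sum_add_distrib,
    Finset.sum_sub_distrib, Finset.sum_ite_eq', mem_range]
  simp (disch := omega) only [if_pos, if_neg]
  ring

theorem sum_phiCoeff_mul_prime {y : ℕ} (hy : 1 ≤ y) (hyq : p * y < q) (F : ℕ → ℤ) :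
    ∑ e ∈ range (p * y + 1), phiCoeff p q e * F e =
      ∑ j ∈ range (y + 1), F (p * j) - ∑ j ∈ range y, F (p * j + 1) := by
  have h1 : ∀ e ∈ range (p * y + 1), phiCoeff p q e * F e = (if p ∣ e then F e else 0) -
      (if 1 ≤ e ∧ p ∣ e - 1 then F e else 0) := by
    intro e he
    rw [mem_range] at he
    rw [phiCoeff_of_lt_second hp hq hpq (by omega)]
    split_ifs <;> ring
  rw [Finset.sum_congr rfl h1, Finset.sum_sub_distrib, sum_range_dvd hp.pos,
    Nat.mul_div_cancel_left _ hp.pos]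
  congr 1
  have hpy : p ≤ p * y := Nat.le_mul_of_pos_right _ hy
  have hp2 := hp.two_le
  rw [Finset.sum_range_succ', if_neg (by omega), add_zero]
  obtain ⟨z, hz⟩ : ∃ z, p * y = z + 1 := ⟨p * y - 1, by omega⟩
  have hzy : z / p + 1 = y := by
    obtain ⟨w, rfl⟩ : ∃ w, y = w + 1 := ⟨y - 1, by omega⟩
    have h2 : z = p * w + (p - 1) := by rw [mul_add] at hz; omega
    rw [h2, Nat.mul_add_div hp.pos, Nat.div_eq_of_lt (by omega), add_zero]
  rw [hz]
  simp only [Nat.add_sub_cancel, Nat.le_add_left, true_and]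
  rw [sum_range_dvd hp.pos z (fun e => F (e + 1)), hzy]

end

/-! ### The value 2 when q is not -1 mod p -/

section
variable {p q : ℕ} (hp : p.Prime) (hq : q.Prime) (hpq : p < q)
include hp hq hpq

theorem truncProd_of_lt_three_halves (h1 : p + 1 < q) (h2 : 2 * q < 3 * p) :
    truncProd p q (q + 1) (q + 1) (3 * p + 1 : ℕ) = 2 := by
  have hn : 3 * q ≤ p * q := Nat.mul_le_mul_right q (by omega)
  rw [truncProd, sum_phiCoeff_second hp hq hpq h1 (by omega)
    (fun e => ∑ l ∈ range (q + 1), phiCoeff p q l * invCoeff p q ((3 * p + 1 : ℕ) - e - l))]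
  rw [sum_phiCoeff_second hp hq hpq h1 (by omega) (fun l => invCoeff p q ((3 * p + 1 : ℕ) - _ - l)),
    sum_phiCoeff_second hp hq hpq h1 (by omega) (fun l => invCoeff p q ((3 * p + 1 : ℕ) - _ - l)),
    sum_phiCoeff_second hp hq hpq h1 (by omega) (fun l => invCoeff p q ((3 * p + 1 : ℕ) - _ - l)),
    sum_phiCoeff_second hp hq hpq h1 (by omega) (fun l => invCoeff p q ((3 * p + 1 : ℕ) - _ - l)),
    sum_phiCoeff_second hp hq hpq h1 (by omega) (fun l => invCoeff p q ((3 * p + 1 : ℕ) - _ - l))]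
  simp (disch := omega) only [invCoeff_eq_one, invCoeff_eq_neg_one, invCoeff_eq_zero_mid,
    invCoeff_eq_zero_high]
  norm_num

theorem truncProd_of_lt_two (h1 : 3 * p < 2 * q) (h2 : q + 1 < 2 * p) :
    truncProd p q (p + 1) (2 * p + 1) (2 * q + 1 : ℕ) = 2 := by
  have hp2 := hp.two_le
  have hn : 3 * q ≤ p * q := Nat.mul_le_mul_right q (by omega)
  rw [truncProd, sum_phiCoeff_succ_prime hp hq hpq (by omega)
    (fun e => ∑ l ∈ range (2 * p + 1), phiCoeff p q l * invCoeff p q ((2 * q + 1 : ℕ) - e - l))]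
  rw [sum_phiCoeff_two_mul hp hq hpq (by omega) h2 (fun l => invCoeff p q ((2 * q + 1 : ℕ) - _ - l)),
    sum_phiCoeff_two_mul hp hq hpq (by omega) h2 (fun l => invCoeff p q ((2 * q + 1 : ℕ) - _ - l)),
    sum_phiCoeff_two_mul hp hq hpq (by omega) h2 (fun l => invCoeff p q ((2 * q + 1 : ℕ) - _ - l))]
  simp (disch := omega) only [invCoeff_eq_one, invCoeff_eq_neg_one, invCoeff_eq_zero_mid,
    invCoeff_eq_zero_high]
  norm_num

theorem truncProd_of_two_mul_lt {y d : ℕ} (hy : 1 ≤ y) (hd : 1 ≤ d) (hd' : d + 2 ≤ p)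
    (hqy : q = p * y + p + d) :
    truncProd p q (p + 1) (p * y + 1) (q + 1 : ℕ) = 2 := by
  have hp2 := hp.two_le
  have hn : 3 * q ≤ p * q := Nat.mul_le_mul_right q (by omega)
  have hpy : p ≤ p * y := Nat.le_mul_of_pos_right _ hy
  -- The first truncation is 1 - X + X^p; `F` is its periodic convolution with 1/Φ_{pq}.
  set F : ℤ → ℤ := fun v => invCoeff p q v - invCoeff p q (v - 1) + invCoeff p q (v - p) with hF
  have h1 : truncProd p q (p + 1) (p * y + 1) (q + 1 : ℕ) =
      ∑ l ∈ range (p * y + 1), phiCoeff p q l * F ((q + 1 : ℕ) - l) := by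
    rw [truncProd, sum_phiCoeff_succ_prime hp hq hpq (by omega)
      (fun e => ∑ l ∈ range (p * y + 1), phiCoeff p q l * invCoeff p q ((q + 1 : ℕ) - e - l)),
      ← Finset.sum_sub_distrib, ← Finset.sum_add_distrib]
    refine Finset.sum_congr rfl fun l _ => ?_
    simp only [hF, Nat.cast_zero, sub_zero, Nat.cast_one, sub_right_comm _ _ (l : ℤ)]
    ring
  have hstep : ∀ j < y, p * j + p ≤ p * y := fun j hj => by
    rw [← Nat.mul_succ]; exact Nat.mul_le_mul_left p hj
  have hstep0 : ∀ j, j ≠ 0 → p ≤ p * j := fun j hj => Nat.le_mul_of_pos_right _ (by omega)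
  -- Only l = py in the positive progression and l = 1 in the negative one survive: F(p+d+1) = 1,
  -- which needs d+1 < p, and F(q) = -1.
  rw [h1, sum_phiCoeff_mul_prime hp hq hpq hy (by omega) (fun l => F ((q + 1 : ℕ) - l)),
    Finset.sum_range_succ, Finset.sum_eq_zero, Finset.sum_eq_single 0]
  · simp only [hF]
    simp (disch := omega) only [invCoeff_eq_one, invCoeff_eq_neg_one, invCoeff_eq_zero_mid]
    norm_num
  · intro j hj hj0
    rw [mem_range] at hj
    have h2 := hstep j hj
    have h3 := hstep0 j hj0
    simp only [hF]
    simp (disch := omega) only [invCoeff_eq_zero_mid]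
    norm_num
  · intro h
    simp at h
    omega
  · intro j hj
    rw [mem_range] at hj
    have h2 := hstep j hj
    simp only [hF]
    rcases Nat.eq_zero_or_pos j with rfl | hj0
    · simp (disch := omega) only [invCoeff_eq_neg_one, invCoeff_eq_zero_mid]
      norm_num
    · have h3 := hstep0 j (by omega)
      simp (disch := omega) only [invCoeff_eq_zero_mid]
      norm_num

/-- Write q = Yp + d, where d is neither 0 nor p-1. One family of witnesses serves Y ≥ 2. For Y = 1
the cases are separated by 2q against 3p, equality being impossible for primes, and parity rules out
d = 1. -/
theorem exists_truncProd_eq_two (hmod : ¬ (q : ℤ) ≡ -1 [ZMOD (p : ℤ)]) :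
    ∃ i J u : ℕ, 1 ≤ i ∧ i ≤ primePhi p q ∧ 1 ≤ J ∧ J ≤ primePhi p q ∧ i + J ≤ u ∧ u < p * q ∧
      truncProd p q i J u = 2 := by
  have hp2 := hp.two_le
  have hphi := phi_add hp2 hpq
  have hdm := Nat.div_add_mod q p
  have hlt := Nat.mod_lt q hp.pos
  have hd0 : q % p ≠ 0 := by
    intro h
    rcases (Nat.dvd_prime hq).1 (Nat.dvd_of_mod_eq_zero h) with h | h <;> omega
  have hd1 : q % p + 1 ≠ p := by
    intro h
    apply hmod
    apply Int.ModEq.symm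
    rw [Int.modEq_iff_dvd]
    refine ⟨q / p + 1, ?_⟩
    zify at hdm h
    linear_combination -hdm + h
  have hp3 : 3 ≤ p := by
    by_contra h
    obtain rfl : p = 2 := by omega
    omega
  have hn : 3 * q ≤ p * q := Nat.mul_le_mul_right q (by omega)
  generalize hY : q / p = Y at *
  generalize hD : q % p = d at *
  have hY1 : Y ≠ 0 := by
    rintro rfl
    omega
  rcases Nat.lt_or_ge Y 2 with hY2 | hY2
  · obtain rfl : Y = 1 := by omega
    rw [mul_one] at hdm
    have h3 : 2 * q ≠ 3 * p := by
      intro h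
      have h4 : p ∣ 2 * q := ⟨3, by omega⟩
      rcases (hp.dvd_mul).1 h4 with h5 | h5
      · have := Nat.le_of_dvd two_pos h5
        omega
      · rcases (Nat.dvd_prime hq).1 h5 with h6 | h6 <;> omega
    have hd2 : d ≠ 1 := by
      rintro rfl
      have h4 : p % 2 = 1 := hp.eq_two_or_odd.resolve_left (by omega)
      have h5 : q % 2 = 1 := hq.eq_two_or_odd.resolve_left (by omega)
      omega
    rcases Nat.lt_or_ge (2 * q) (3 * p) with h | h
    · exact ⟨q + 1, q + 1, 3 * p + 1, by omega, by omega, by omega, by omega, by omega, by omega,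
        truncProd_of_lt_three_halves hp hq hpq (by omega) h⟩
    · exact ⟨p + 1, 2 * p + 1, 2 * q + 1, by omega, by omega, by omega, by omega, by omega,
        by omega, truncProd_of_lt_two hp hq hpq (by omega) (by omega)⟩
  · obtain ⟨y, rfl⟩ : ∃ y, Y = y + 1 := ⟨Y - 1, by omega⟩
    rw [mul_add, mul_one] at hdm
    exact ⟨p + 1, p * y + 1, q + 1, by omega, by omega, by omega, by omega, by omega,
      by omega, truncProd_of_two_mul_lt hp hq hpq (by omega) (by omega) (by omega) hdm.symm⟩

end

/-! ### Counting hits of a cell in the grid ℤ/p × ℤ/q -/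

/-- The indicator of the cell of row `ρ` modulo `p` and column `e` modulo `q`. -/
def cell (p q ρ e : ℕ) (j m : ℤ) : ℤ := if (p : ℤ) ∣ j - ρ ∧ (q : ℤ) ∣ m - e then 1 else 0

theorem sum_range_ite_of_iff {N : ℕ} {f : ℕ → ℤ} {z : ℤ} {P : Prop} [Decidable P]
    (hf : ∀ h < N, f h = if (h : ℤ) = z ∧ P then 1 else 0) :
    ∑ h ∈ range N, f h = if 0 ≤ z ∧ z < N ∧ P then 1 else 0 := by
  rw [Finset.sum_congr rfl fun h hh => hf h (by simpa using hh)]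
  by_cases hz : 0 ≤ z ∧ z < N ∧ P
  · obtain ⟨h0, h1, h2⟩ := hz
    lift z to ℕ using h0
    rw [if_pos ⟨by omega, h1, h2⟩, Finset.sum_eq_single z]
    · simp [h2]
    · intro b _ hb
      rw [if_neg]
      rintro ⟨h3, -⟩
      omega
    · intro h3
      simp at h3
      omega
  · rw [if_neg hz]
    refine Finset.sum_eq_zero fun h hh => ?_
    rw [mem_range] at hh
    rw [if_neg]
    rintro ⟨h3, h4⟩
    exact hz ⟨by omega, by omega, h4⟩

theorem dvd_sub_iff_eq_of_lt {n : ℕ} {x y z : ℤ} (hz : (n : ℤ) ∣ z - y) (h0 : 0 ≤ x) (h1 : x < n)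
    (h2 : 0 ≤ z) (h3 : z < n) : (n : ℤ) ∣ x - y ↔ x = z := by
  constructor
  · intro h
    have h4 := dvd_sub h hz
    rw [sub_sub_sub_cancel_right] at h4
    have := Int.eq_zero_of_abs_lt_dvd h4 (by rw [abs_lt]; omega)
    omega
  · rintro rfl
    exact hz

section
variable {p q t ρ e A' : ℕ} (hρ : ρ < p) (he : e < q) (htq : t ≤ q) (ht : 0 < t)
  (hA' : A' ≤ (p - 1) * t)
include hρ he htq ht hA'

omit hρ he htq in
theorem div_lt_of_lt_mul {h : ℕ} (hh : h < A') : h / t < p - 1 :=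
  (Nat.div_lt_iff_lt_mul ht).2 (by omega)

/-- Row and column are quotient and remainder of h by t, so only h = jt + e can hit, where j is the
row ρ - s reduced mod p. -/
theorem sum_cell_short {s j : ℕ} (hj : j < p) (hs : (p : ℤ) ∣ (j : ℤ) - (ρ - s)) :
    ∑ h ∈ range A', cell p q ρ e ((h / t : ℕ) + s) (h % t : ℕ) =
      if e < t ∧ j * t + e < A' then 1 else 0 := by
  rw [sum_range_ite_of_iff (z := (j * t + e : ℕ)) (P := e < t)]
  · congr 1
    simp only [eq_iff_iff]
    omega
  · intro h hh
    have h1 := div_lt_of_lt_mul ht hA' hh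
    have h2 := Nat.mod_lt h ht
    have h1' : h / t < p := by omega
    rw [cell]
    refine if_congr ?_ rfl rfl
    rw [add_sub_assoc, ← neg_sub (ρ : ℤ), ← sub_eq_add_neg,
      dvd_sub_iff_eq_of_lt hs (Int.natCast_nonneg _) (by exact_mod_cast h1') (by omega) (by omega),
      dvd_sub_iff_eq_of_lt (y := e) (z := e) (by simp) (Int.natCast_nonneg _)
        (by exact_mod_cast h2.trans_le htq) (by omega) (by omega)]
    norm_cast
    constructor
    · rintro ⟨h3, h4⟩
      have := Nat.div_add_mod h t
      rw [h3, h4, mul_comm] at this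
      omega
    · rintro ⟨rfl, h4⟩
      rw [mul_comm, Nat.mul_add_div ht, Nat.div_eq_of_lt h4, Nat.mul_add_mod, Nat.mod_eq_of_lt h4]
      simp

omit hρ htq ht hA' in
-- The row is fixed and at most q consecutive columns are visited; z is the cyclic distance from
-- column v to column e.
theorem sum_cell_long {v : ℕ} {s z : ℤ} (hAq : A' ≤ q) (hv : v ≤ q)
    (hz : z = if v ≤ e then (e : ℤ) - v else e + q - v) :
    ∑ h ∈ range A', cell p q ρ e s (v + h) =
      if 0 ≤ z ∧ z < A' ∧ (p : ℤ) ∣ s - ρ then 1 else 0 := by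
  apply sum_range_ite_of_iff
  intro h hh
  rw [cell]
  refine if_congr ?_ rfl rfl
  rw [and_comm, and_congr_left_iff]
  intro _
  rw [add_comm, add_sub_assoc, ← neg_sub (e : ℤ), ← sub_eq_add_neg]
  apply dvd_sub_iff_eq_of_lt <;> split_ifs at hz <;> try omega
  · rw [hz, sub_self]; exact dvd_zero _
  · rw [hz]; ring_nf; exact dvd_rfl

omit htq in
-- The column forces h = z; the last two inequalities say that (A'-1-z)/t has integer part j.
theorem sum_cell_descending {v s j : ℕ} {z : ℤ} (hv : v ≤ q) (hAq : A' ≤ q) (hj : j < p)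
    (hs : (p : ℤ) ∣ (j : ℤ) - (ρ - s))
    (hz : z = if v ≤ e then (e : ℤ) - v else e + q - v) :
    ∑ h ∈ range A', cell p q ρ e (((A' - 1 - h) / t : ℕ) + s) (v + h) =
      if 0 ≤ z ∧ z < A' ∧ (j * t + z < A' ∧ A' ≤ j * t + t + z) then 1 else 0 := by
  apply sum_range_ite_of_iff
  intro h hh
  have h1 := div_lt_of_lt_mul (h := A' - 1 - h) ht hA' (by omega)
  have h1' : (A' - 1 - h) / t < p := by omega
  have h2 : (q : ℤ) ∣ v + h - e ↔ (h : ℤ) = z := by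
    rw [add_comm, add_sub_assoc, ← neg_sub (e : ℤ), ← sub_eq_add_neg]
    apply dvd_sub_iff_eq_of_lt <;> split_ifs at hz <;> try omega
    · rw [hz, sub_self]; exact dvd_zero _
    · rw [hz]; ring_nf; exact dvd_rfl
  rw [cell]
  refine if_congr ?_ rfl rfl
  rw [and_comm, h2]
  refine and_congr_right fun h3 => ?_
  rw [add_sub_assoc, ← neg_sub (ρ : ℤ), ← sub_eq_add_neg,
      dvd_sub_iff_eq_of_lt hs (Int.natCast_nonneg _) (by exact_mod_cast h1') (by omega) (by omega),
      Nat.cast_inj,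
      Nat.div_eq_iff ht, ← h3]
  norm_cast
  omega

end

/-- `Al`, `Jt`, `R` stand for αt, jt, ρt, which keeps the hypotheses linear. This is row ρ = p-1,
missed by the unshifted sums, whose rows are at most p-2. -/
theorem cell_bound_last {q t e A' a0 ε Al Jt R z1 z2 z3 : ℤ} (he0 : 0 ≤ e)
    (ha : 0 ≤ a0) (ha0 : a0 < t) (hε0 : 0 ≤ ε) (hε : ε ≤ 1) (hAl : 0 ≤ Al) (hA' : A' < R) (hRt : R + t = q + 1)
    (hjt : Jt + (Al + t) = R)
    (hz1 : z1 = e - t ∧ t ≤ e ∨ z1 = e + q - t ∧ e < t)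
    (hz2 : z2 = e - (a0 + ε) ∧ a0 + ε ≤ e ∨ z2 = e + q - (a0 + ε) ∧ e < a0 + ε)
    (hz3 : z3 = e - (Al + a0 + t) ∧ Al + a0 + t ≤ e ∨
      z3 = e + q - (Al + a0 + t) ∧ e < Al + a0 + t) :
    |(0 - (if 0 ≤ z1 ∧ z1 < A' then 1 else 0)) - ((if e < t ∧ Jt + e < A' then 1 else 0) - 0)
      - (0 - (if 0 ≤ z2 ∧ z2 < A' ∧ Jt + z2 < A' ∧ A' ≤ Jt + t + z2 then 1 else 0))
      + ((if 0 ≤ z3 ∧ z3 < A' then 1 else 0) - 0)| ≤ (1 : ℤ) := by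
  rw [abs_le]
  rcases hz1 with ⟨rfl, h1⟩ | ⟨rfl, h1⟩ <;> rcases hz2 with ⟨rfl, h2⟩ | ⟨rfl, h2⟩ <;>
    rcases hz3 with ⟨rfl, h3⟩ | ⟨rfl, h3⟩ <;> split_ifs <;> omega

/-- Row ρ = α: the shift by α+1 sends it to row p-1, so the shifted sums vanish. -/
theorem cell_bound_diag {q t e A' a0 ε Jt R z1 z2 z3 : ℤ} (he0 : 0 ≤ e) (he : e < q)
    (ha : 0 ≤ a0) (ha0 : a0 < t) (hε0 : 0 ≤ ε) (hε : ε ≤ 1) (hR : 0 ≤ R)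
    (hA' : A' + t ≤ q) (hαt : R + t + t ≤ q + 1) (hjt : Jt + t = q + 1)
    (hz1 : z1 = e - t ∧ t ≤ e ∨ z1 = e + q - t ∧ e < t)
    (hz2 : z2 = e - (a0 + ε) ∧ a0 + ε ≤ e ∨ z2 = e + q - (a0 + ε) ∧ e < a0 + ε)
    (hz3 : z3 = e - (R + a0 + t) ∧ R + a0 + t ≤ e ∨ z3 = e + q - (R + a0 + t) ∧ e < R + a0 + t) :
    |((if e < t ∧ R + e < A' then 1 else 0) - 0) - (0 - (if 0 ≤ z1 ∧ z1 < A' then 1 else 0))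
      - ((if 0 ≤ z2 ∧ z2 < A' then 1 else 0) - 0)
      + (0 - (if 0 ≤ z3 ∧ z3 < A' ∧ R + z3 < A' ∧ A' ≤ R + t + z3 then 1 else 0))| ≤ (1 : ℤ) := by
  rw [abs_le]
  rcases hz1 with ⟨rfl, h1⟩ | ⟨rfl, h1⟩ <;> rcases hz2 with ⟨rfl, h2⟩ | ⟨rfl, h2⟩ <;>
    rcases hz3 with ⟨rfl, h3⟩ | ⟨rfl, h3⟩ <;> split_ifs <;> omega

/-- In the remaining rows the four fixed-row sums vanish. -/
theorem cell_bound_generic {q t e A' a0 ε Al Jt R z2 z3 : ℤ} (he0 : 0 ≤ e)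
    (ha : 0 ≤ a0) (ha0 : a0 < t) (hε0 : 0 ≤ ε) (hε : ε ≤ 1) (hAl : 0 ≤ Al) (hA0 : 0 ≤ A')
    (hR : 0 ≤ R) (hJ0 : 0 ≤ Jt) (hA' : A' + t ≤ q) (hαt : Al + t + t ≤ q + 1)
    (hjt : Jt + (Al + t) = R ∨ R + t ≤ Al ∧ Jt + (Al + t) = R + q + 1)
    (hz2 : z2 = e - (a0 + ε) ∧ a0 + ε ≤ e ∨ z2 = e + q - (a0 + ε) ∧ e < a0 + ε)
    (hz3 : z3 = e - (Al + a0 + t) ∧ Al + a0 + t ≤ e ∨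
      z3 = e + q - (Al + a0 + t) ∧ e < Al + a0 + t) :
    |((if e < t ∧ R + e < A' then 1 else 0) - 0) - ((if e < t ∧ Jt + e < A' then 1 else 0) - 0)
      - (0 - (if 0 ≤ z2 ∧ z2 < A' ∧ Jt + z2 < A' ∧ A' ≤ Jt + t + z2 then 1 else 0))
      + (0 - (if 0 ≤ z3 ∧ z3 < A' ∧ R + z3 < A' ∧ A' ≤ R + t + z3 then 1 else 0))| ≤ (1 : ℤ) := by
  rw [abs_le]
  rcases hjt with hjt | hjt <;> rcases hz2 with ⟨rfl, h2⟩ | ⟨rfl, h2⟩ <;>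
    rcases hz3 with ⟨rfl, h3⟩ | ⟨rfl, h3⟩ <;> split_ifs <;> omega

/-- The cell sums of a product of two truncations of `Φ_{pq}` and `1 / Φ_{pq}`, for
`q ≡ -1 (mod p)`. -/
theorem abs_sum_cell_le {p q t ρ e A' α a0 ε : ℕ} (hp : 2 ≤ p) (hpq : p < q) (htp : t * p = q + 1)
    (hρ : ρ < p) (he : e < q) (hα : α + 2 ≤ p) (ha0 : a0 < t) (hε : ε ≤ 1)
    (hA' : A' < (p - 1) * t) :
    |(∑ h ∈ range A', cell p q ρ e ((h / t : ℕ) + (0 : ℕ)) (h % t : ℕ)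
      - ∑ h ∈ range A', cell p q ρ e (-1) (t + h))
      - (∑ h ∈ range A', cell p q ρ e ((h / t : ℕ) + (α + 1 : ℕ)) (h % t : ℕ)
      - ∑ h ∈ range A', cell p q ρ e α (t + h))
      - (∑ h ∈ range A', cell p q ρ e α ((a0 + ε : ℕ) + h)
      - ∑ h ∈ range A',
          cell p q ρ e (((A' - 1 - h) / t : ℕ) + (α + 1 : ℕ)) ((a0 + ε : ℕ) + h))
      + (∑ h ∈ range A', cell p q ρ e (-1) ((α * t + a0 + t : ℕ) + h)
      - ∑ h ∈ range A',
          cell p q ρ e (((A' - 1 - h) / t : ℕ) + (0 : ℕ)) ((α * t + a0 + t : ℕ) + h))| ≤ 1 := by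
  have ht0 : 0 < t := Nat.pos_of_ne_zero (by rintro rfl; omega)
  have hpt : (p - 1) * t + t = q + 1 := by
    obtain ⟨p', rfl⟩ : ∃ p', p = p' + 1 := ⟨p - 1, by omega⟩
    rw [Nat.add_sub_cancel, ← htp]; ring
  have htq : t ≤ q := by
    obtain ⟨p', rfl⟩ : ∃ p', p = p' + 2 := ⟨p - 2, by omega⟩
    have h1 : t * (p' + 2) = t * p' + t + t := by ring
    omega
  have hαt : α * t + t ≤ (p - 1) * t := by
    rw [← Nat.succ_mul]
    exact Nat.mul_le_mul_right t (by omega)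
  -- j is ρ - (α+1) reduced mod p; wrapping around adds tp = q+1 to jt.
  obtain ⟨j, hj, hjs, hjt⟩ : ∃ j < p, (p : ℤ) ∣ (j : ℤ) - (ρ - (α + 1 : ℕ)) ∧
      ((α + 1 ≤ ρ ∧ j * t + (α * t + t) = ρ * t) ∨
        (ρ ≤ α ∧ j * t + (α * t + t) = ρ * t + q + 1)) := by
    rcases le_or_gt (α + 1) ρ with h | h
    · refine ⟨ρ - (α + 1), by omega, ?_, Or.inl ⟨h, ?_⟩⟩
      · rw [Nat.cast_sub h, sub_self]; exact dvd_zero _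
      · zify [h]; ring
    · refine ⟨ρ + p - (α + 1), by omega, ?_, Or.inr ⟨by omega, ?_⟩⟩
      · rw [Nat.cast_sub (by omega)]
        exact ⟨1, by push_cast; ring⟩
      · rw [add_assoc (ρ * t), ← htp]
        zify [show α + 1 ≤ ρ + p by omega]; ring
  have hρt : ρ * t ≤ (p - 1) * t := Nat.mul_le_mul_right t (by omega)
  have hm1 : (p : ℤ) ∣ -1 - ρ ↔ ρ = p - 1 := by
    rw [dvd_sub_comm, dvd_sub_iff_eq_of_lt (z := (p : ℤ) - 1) (by simp) (by omega) (by omega)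
      (by omega) (by omega)]
    omega
  have hρα : (p : ℤ) ∣ α - ρ ↔ ρ = α := by
    rw [dvd_sub_iff_eq_of_lt (z := ρ) (by simp) (by omega) (by omega) (by omega) (by omega)]
    omega
  obtain ⟨z1, hz1⟩ : ∃ z : ℤ, z = if t ≤ e then (e : ℤ) - t else e + q - t := ⟨_, rfl⟩
  obtain ⟨z2, hz2⟩ : ∃ z : ℤ, z = if a0 + ε ≤ e then (e : ℤ) - (a0 + ε : ℕ)
    else e + q - (a0 + ε : ℕ) := ⟨_, rfl⟩
  obtain ⟨z3, hz3⟩ : ∃ z : ℤ, z = if α * t + a0 + t ≤ e then (e : ℤ) - (α * t + a0 + t : ℕ)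
    else e + q - (α * t + a0 + t : ℕ) := ⟨_, rfl⟩
  rw [sum_cell_short hρ he htq ht0 hA'.le hρ (by simp),
    sum_cell_short hρ he htq ht0 hA'.le hj hjs,
    sum_cell_long he (by omega) htq hz1, sum_cell_long he (by omega) htq hz1,
    sum_cell_long he (by omega) (by omega) hz2, sum_cell_long he (by omega) (by omega) hz3,
    sum_cell_descending hρ he ht0 hA'.le (by omega) (by omega) hj hjs hz2,
    sum_cell_descending hρ he ht0 hA'.le (by omega) (by omega) hρ (by simp) hz3]
  simp only [hm1, hρα]
  have hz1' : z1 = (e : ℤ) - t ∧ (t : ℤ) ≤ e ∨ z1 = (e : ℤ) + q - t ∧ (e : ℤ) < t := by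
    split_ifs at hz1 <;> omega
  have hz2' : z2 = (e : ℤ) - (a0 + ε) ∧ (a0 + ε : ℤ) ≤ e ∨
      z2 = (e : ℤ) + q - (a0 + ε) ∧ (e : ℤ) < a0 + ε := by
    split_ifs at hz2 <;> omega
  have hz3' : z3 = (e : ℤ) - ((α * t : ℕ) + a0 + t) ∧ ((α * t : ℕ) : ℤ) + a0 + t ≤ e ∨
      z3 = (e : ℤ) + q - ((α * t : ℕ) + a0 + t) ∧ (e : ℤ) < (α * t : ℕ) + a0 + t := by
    split_ifs at hz3 <;> omega
  simp only [← Nat.cast_mul]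
  by_cases c1 : ρ = p - 1
  · have c2 : ¬ p - 1 = α := by omega
    have c3 : ρ * t = (p - 1) * t := by rw [c1]
    have c4 : ¬ (e < t ∧ ρ * t + e < A') := by omega
    have c5 : ¬ (0 ≤ z3 ∧ z3 < A' ∧ ((ρ * t : ℕ) : ℤ) + z3 < A' ∧
        (A' : ℤ) ≤ (ρ * t : ℕ) + t + z3) := by omega
    rw [if_neg c4, if_neg c5]
    simp only [c1, c2, and_true, and_false, if_false]
    have h := cell_bound_last (q := q) (t := t) (e := e) (A' := A') (a0 := a0) (ε := ε)
      (Al := (α * t : ℕ)) (Jt := (j * t : ℕ)) (R := (ρ * t : ℕ)) (by omega) (by omega) (by omega)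
      (by omega) (by omega) (by omega) (by omega) (by omega) (by omega) hz1' hz2' hz3'
    exact_mod_cast h
  · simp only [c1, and_false, if_false]
    by_cases c2 : ρ = α
    · have c3 : ρ * t = α * t := by rw [c2]
      have c4 : ¬ (e < t ∧ j * t + e < A') := by omega
      have c5 : ¬ (0 ≤ z2 ∧ z2 < A' ∧ ((j * t : ℕ) : ℤ) + z2 < A' ∧
          (A' : ℤ) ≤ (j * t : ℕ) + t + z2) := by omega
      rw [if_neg c4, if_neg c5]
      simp only [c2, and_true]
      have h := cell_bound_diag (q := q) (t := t) (e := e) (A' := A') (a0 := a0) (ε := ε)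
        (Jt := (j * t : ℕ)) (R := (α * t : ℕ)) (by omega) (by omega) (by omega)
        (by omega) (by omega) (by omega) (by omega) (by omega) (by omega) (by omega) hz1' hz2' hz3'
      exact_mod_cast h
    · simp only [c2, and_false, if_false]
      have c3 : ρ < α → ρ * t + t ≤ α * t := fun h => by
        rw [← Nat.succ_mul]; exact Nat.mul_le_mul_right t h
      have h := cell_bound_generic (q := q) (t := t) (e := e) (A' := A') (a0 := a0) (ε := ε)
        (Al := (α * t : ℕ)) (Jt := (j * t : ℕ)) (R := (ρ * t : ℕ)) (by omega) (by omega) (by omega)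
        (by omega) (by omega) (by omega) (by omega) (by omega) (by omega) (by omega) (by omega)
        (by omega) hz2' hz3'
      exact_mod_cast h

/-! ### Paired terms of Φ_{pq} when tp = q+1 -/

/-- Exponents of the positive terms of `Φ_{pq}` when `t * p = q + 1`. -/
def posExp (p q t h : ℕ) : ℕ := h / t * q + h % t * p

/-- Sums of consecutive pairs of terms of `Φ_{pq}` when `t * p = q + 1`. -/
noncomputable def pairSum (p q t A : ℕ) : ℤ[X] :=
  ∑ h ∈ range A, (X ^ posExp p q t h - X ^ (h * p + 1))

/-- The quotient of `(1 - X ^ q) * pairSum p q t A` by `1 - X`. -/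
noncomputable def pairSumQuot (p q t A : ℕ) : ℤ[X] :=
  ∑ m ∈ range A, (X ^ (m * p) - X ^ (m * p + ((A - 1 - m) / t + 1) * q))

section
variable {p q t : ℕ} (ht : 0 < t) (htp : t * p = q + 1)
include ht htp

omit ht in
theorem posExp_add_div (h : ℕ) : posExp p q t h + h / t = h * p := by
  have h1 := Nat.div_add_mod h t
  rw [posExp]
  conv_rhs => rw [← h1, add_mul, mul_right_comm, htp]
  ring

/-- Multiplication by X^p moves each pair to the next, except that the positive exponent grows by
only p-1 when h+1 is a multiple of t. These defects, multiplied by 1 - X^q, telescope to the last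
term. -/
theorem one_sub_mul_pairSum_succ (A : ℕ) :
    (1 - X ^ q) * pairSum p q t (A + 1) = X ^ p * ((1 - X ^ q) * pairSum p q t A) +
      (1 - X) * (1 - X ^ ((A / t + 1) * q)) := by
  induction A with
  | zero => simp [pairSum, posExp]; ring
  | succ A ih =>
    have h1 : (1 - X ^ q : ℤ[X]) * (X ^ posExp p q t (A + 1)) =
        X ^ p * ((1 - X ^ q) * X ^ posExp p q t A) +
          (1 - X) * (X ^ ((A / t + 1) * q) - X ^ (((A + 1) / t + 1) * q)) := by
      have h2 := posExp_add_div htp (A + 1)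
      have h3 := posExp_add_div htp A
      by_cases hd : t ∣ A + 1
      · obtain ⟨c, hc⟩ := hd
        have hc0 : c ≠ 0 := by rintro rfl; omega
        have h4 : (A + 1) / t = c := by rw [hc, Nat.mul_div_cancel_left _ ht]
        have h5 : A / t + 1 = c := by
          rw [← h4, Nat.succ_div_of_dvd ⟨c, hc⟩]
        have h6 : posExp p q t (A + 1) = c * q := by
          rw [posExp, h4, hc, Nat.mul_mod_right, zero_mul, add_zero]
        have h7 : p + posExp p q t A = c * q + 1 := by
          rw [h4] at h2
          rw [add_mul, one_mul] at h2
          omega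
        rw [h4, h5, h6, mul_left_comm, ← pow_add, h7, pow_succ, add_mul c, pow_add, one_mul]
        ring
      · rw [Nat.succ_div_of_not_dvd hd] at h2 ⊢
        rw [add_mul, one_mul] at h2
        rw [sub_self, mul_zero, add_zero, mul_left_comm, ← pow_add]
        congr 2
        omega
    have h2 : pairSum p q t (A + 1 + 1) = pairSum p q t (A + 1) +
        (X ^ posExp p q t (A + 1) - X ^ ((A + 1) * p + 1)) := by
      rw [pairSum, Finset.sum_range_succ]; rfl
    have h3 : pairSum p q t (A + 1) = pairSum p q t A +
        (X ^ posExp p q t A - X ^ (A * p + 1)) := by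
      rw [pairSum, Finset.sum_range_succ]; rfl
    have h4 : (X : ℤ[X]) ^ ((A + 1) * p + 1) = X ^ p * X ^ (A * p + 1) := by
      rw [← pow_add]; congr 1; ring
    rw [h2]
    linear_combination ih + h1 - (1 - X ^ q) * h4 - X ^ p * (1 - X ^ q) * h3

/-- Unrolling the recursion, every inhomogeneous term carries the factor 1 - X. -/
theorem one_sub_mul_pairSum (A : ℕ) :
    (1 - X ^ q) * pairSum p q t A = (1 - X) * pairSumQuot p q t A := by
  induction A with
  | zero => simp [pairSum, pairSumQuot]
  | succ A ih =>
    rw [one_sub_mul_pairSum_succ ht htp, ih, pairSumQuot, pairSumQuot, Finset.sum_range_succ']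
    have h1 : ∑ m ∈ range A, ((X : ℤ[X]) ^ ((m + 1) * p) -
        X ^ ((m + 1) * p + ((A + 1 - 1 - (m + 1)) / t + 1) * q)) =
        X ^ p * ∑ m ∈ range A, (X ^ (m * p) - X ^ (m * p + ((A - 1 - m) / t + 1) * q)) := by
      rw [Finset.mul_sum]
      refine Finset.sum_congr rfl fun m _ => ?_
      rw [show A + 1 - 1 - (m + 1) = A - 1 - m by omega, mul_sub, ← pow_add, ← pow_add]
      congr 2 <;> ring
    rw [h1]
    simp
    ring

/-- The product of two truncations of `Φ_{pq}` with the numerator of `1 / Φ_{pq}`. -/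
theorem pairSum_mul_pairSum_mul_invNum {ε : ℕ} (hε : ε ≤ 1) (A A' : ℕ) :
    (pairSum p q t A + (ε : ℤ[X]) * X ^ posExp p q t A) * (pairSum p q t A' * invNum p q) =
      (1 - X ^ ((A / t + 1) * q)) * pairSum p q t A' -
        (X ^ (posExp p q t A + ε * p) - X ^ (A * p + 1)) * pairSumQuot p q t A' := by
  have h1 : (1 - X : ℤ[X]) * invNum p q = (1 - X ^ p) * (1 - X ^ q) := by
    rw [invNum, ← mul_assoc, mul_comm (1 - X), geom_sum_mul_neg]
  have h2 := one_sub_mul_pairSum_succ ht htp A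
  have h3 : pairSum p q t (A + 1) = pairSum p q t A +
      (X ^ posExp p q t A - X ^ (A * p + 1)) := by
    rw [pairSum, Finset.sum_range_succ]; rfl
  have h4 := one_sub_mul_pairSum ht htp A'
  have h5 : (1 - X : ℤ[X]) ≠ 0 := by
    intro h
    have := congrArg (fun f => coeff f 0) h
    simp at this
  rw [h3] at h2
  apply mul_left_cancel₀ h5
  -- The unpaired term contributes (1 - X^p) times its monomial times the quotient, which merely
  -- moves the existing monomial up by p.
  obtain rfl | rfl : ε = 0 ∨ ε = 1 := by omega
  · simp only [Nat.cast_zero, zero_mul, add_zero]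
    linear_combination pairSum p q t A' * h2 + pairSum p q t A * pairSum p q t A' * h1 -
      (X ^ posExp p q t A - X ^ (A * p + 1)) * h4
  · simp only [Nat.cast_one, one_mul, pow_add]
    linear_combination pairSum p q t A' * h2 + (pairSum p q t A + X ^ posExp p q t A) *
      pairSum p q t A' * h1 - (X ^ posExp p q t A * X ^ p - X ^ (A * p + 1)) * h4

/-- At A = (p-1)t the recursion has A/t + 1 = p, so adding X^{(p-1)q} yields numerator (1 - X)(1 -
X^{pq}). -/
theorem cyclotomic_eq_pairSum_add (hp : p.Prime) (hq : q.Prime) (hpq : p < q) :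
    cyclotomic (p * q) ℤ = pairSum p q t ((p - 1) * t) + X ^ ((p - 1) * q) := by
  have h0 := cyclotomic_mul_invNum hp hq hpq
  have h1 : (1 - X : ℤ[X]) * invNum p q = (1 - X ^ p) * (1 - X ^ q) := by
    rw [invNum, ← mul_assoc, mul_comm (1 - X), geom_sum_mul_neg]
  have h2 := one_sub_mul_pairSum_succ ht htp ((p - 1) * t)
  have h3 : pairSum p q t ((p - 1) * t + 1) = pairSum p q t ((p - 1) * t) +
      (X ^ posExp p q t ((p - 1) * t) - X ^ ((p - 1) * t * p + 1)) := by
    rw [pairSum, Finset.sum_range_succ]; rfl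
  have hp1 : p - 1 + 1 = p := by have := hp.two_le; omega
  have h4 : posExp p q t ((p - 1) * t) = (p - 1) * q := by
    rw [posExp, Nat.mul_div_cancel _ ht, Nat.mul_mod_left, zero_mul, add_zero]
  have h5 : (p - 1) * t * p + 1 = (p - 1) * q + p := by
    rw [mul_assoc, htp, mul_add]
    omega
  have h6 : (X : ℤ[X]) ^ (p * q) = X ^ ((p - 1) * q) * X ^ q := by
    rw [← pow_add]
    congr 1
    conv_lhs => rw [← hp1, add_mul, one_mul]
  rw [h3, h4, h5, Nat.mul_div_cancel _ ht, hp1, h6, pow_add] at h2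
  have h7 : (1 - X : ℤ[X]) * invNum p q ≠ 0 := by
    intro h
    have hq0 : ¬ q = 0 := hq.ne_zero
    have hp0 : ¬ p = 0 := hp.ne_zero
    have := congrArg (fun f => coeff f 0) (h1.symm.trans h)
    simp [mul_coeff_zero, coeff_X_pow, hq0, hp0, eq_comm] at this
  apply mul_right_cancel₀ h7
  rw [h6] at h0
  linear_combination (1 - X) * h0 - h2 -
    (pairSum p q t ((p - 1) * t) + X ^ ((p - 1) * q)) * h1

end

theorem truncLT_add (i : ℕ) (f g : ℤ[X]) : truncLT i (f + g) = truncLT i f + truncLT i g := by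
  ext k
  simp only [coeff_truncLT, coeff_add]
  split_ifs <;> simp

theorem truncLT_sub (i : ℕ) (f g : ℤ[X]) : truncLT i (f - g) = truncLT i f - truncLT i g := by
  ext k
  simp only [coeff_truncLT, coeff_sub]
  split_ifs <;> simp

theorem truncLT_sum (i : ℕ) (s : Finset ℕ) (f : ℕ → ℤ[X]) :
    truncLT i (∑ h ∈ s, f h) = ∑ h ∈ s, truncLT i (f h) := by
  ext k
  simp only [coeff_truncLT, finsetSum_coeff]
  split_ifs <;> simp

theorem truncLT_X_pow_of_lt {i k : ℕ} (h : k < i) : truncLT i (X ^ k) = X ^ k := by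
  ext j
  rw [coeff_truncLT, coeff_X_pow]
  split_ifs <;> first | rfl | omega

theorem truncLT_X_pow_of_le {i k : ℕ} (h : i ≤ k) : truncLT i (X ^ k) = 0 := by
  ext j
  rw [coeff_truncLT, coeff_X_pow, coeff_zero]
  split_ifs <;> first | rfl | omega

/-! ### The bound 1 when q ≡ -1 mod p -/

section
variable {p q t : ℕ} (hp : p.Prime) (hq : q.Prime) (hpq : p < q) (htp : t * p = q + 1)
include hp hq hpq htp

omit hp hq hpq in
theorem pos_of_mul_eq_succ : 0 < t := Nat.pos_of_ne_zero (by rintro rfl; omega)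

/-- The exponents interlace, posExp(h) < hp+1 ≤ posExp(h+1), so a cut either separates pairs (ε = 0)
or splits one (ε = 1). -/
theorem exists_truncLT_cyclotomic_eq {i : ℕ} (hi : i ≤ primePhi p q) :
    ∃ A ε : ℕ, A < (p - 1) * t ∧ ε ≤ 1 ∧
      truncLT i (cyclotomic (p * q) ℤ) = pairSum p q t A + (ε : ℤ[X]) * X ^ posExp p q t A := by
  have ht := pos_of_mul_eq_succ htp
  have hp2 := hp.two_le
  have hphi := phi_add hp2 hpq
  obtain ⟨p', rfl⟩ : ∃ p', p = p' + 1 := ⟨p - 1, by omega⟩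
  rw [Nat.add_sub_cancel] at *
  have hM0 : 0 < p' * t := Nat.mul_pos (by omega) ht
  have hM : p' * t * (p' + 1) = p' * q + p' := by rw [mul_assoc, htp]; ring
  have hpq' : (p' + 1) * q = p' * q + q := by ring
  obtain ⟨M, hMM⟩ : ∃ M, p' * t = M + 1 := ⟨p' * t - 1, by omega⟩
  have hM2 : M * (p' + 1) + 1 = p' * q := by
    rw [hMM] at hM
    have : (M + 1) * (p' + 1) = M * (p' + 1) + p' + 1 := by ring
    omega
  -- The final pair h = M has negative exponent Mp+1 = (p-1)q, which cancels the extra monomial and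
  -- lies beyond φ.
  have hex : ∃ A, i ≤ A * (p' + 1) + 1 := ⟨M, by omega⟩
  classical
  obtain ⟨A, hA1, hA2⟩ : ∃ A, i ≤ A * (p' + 1) + 1 ∧ ∀ h < A, h * (p' + 1) + 1 < i :=
    ⟨Nat.find hex, Nat.find_spec hex, fun h hh => by have := Nat.find_min hex hh; omega⟩
  have hAM : A ≤ M := by
    by_contra hcon
    have := hA2 M (by omega)
    omega
  refine ⟨A, if posExp (p' + 1) q t A < i then 1 else 0, by omega, by split_ifs <;> omega, ?_⟩
  rw [cyclotomic_eq_pairSum_add ht htp hp hq hpq, Nat.add_sub_cancel, truncLT_add, pairSum,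
    truncLT_sum, truncLT_X_pow_of_le (show i ≤ p' * q by omega), add_zero,
    ← Finset.sum_range_add_sum_Ico _ (show A + 1 ≤ p' * t by omega), Finset.sum_range_succ,
    Finset.sum_eq_zero (s := Ico _ _), add_zero, pairSum]
  · congr 1
    · refine Finset.sum_congr rfl fun h hh => ?_
      rw [mem_range] at hh
      have h1 := hA2 h hh
      have h2 : posExp (p' + 1) q t h ≤ h * (p' + 1) + 1 := by
        have := posExp_add_div htp h
        generalize h / t = x at this
        omega
      rw [truncLT_sub, truncLT_X_pow_of_lt h1, truncLT_X_pow_of_lt (by omega)]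
    · rw [truncLT_sub, truncLT_X_pow_of_le hA1, sub_zero]
      split_ifs with h1
      · rw [truncLT_X_pow_of_lt h1]; simp
      · rw [truncLT_X_pow_of_le (by omega)]; simp
  · intro h hh
    rw [mem_Ico] at hh
    have h1 : h / t < p' := (Nat.div_lt_iff_lt_mul ht).2 hh.2
    have h2 := posExp_add_div htp h
    have h3 : (A + 1) * (p' + 1) ≤ h * (p' + 1) := Nat.mul_le_mul_right _ hh.1
    rw [add_mul] at h3
    rw [truncLT_sub, truncLT_X_pow_of_le (by omega), truncLT_X_pow_of_le (by omega), sub_zero]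

omit hp hq hpq htp in
theorem truncProd_eq_polyEval (hp2 : 2 ≤ p) (hpq : p < q) (i J : ℕ) (u : ℤ) :
    truncProd p q i J u = polyEval (resWeight (p * q) u)
      (truncLT i (cyclotomic (p * q) ℤ) * (truncLT J (cyclotomic (p * q) ℤ) * invNum p q)) := by
  have hshift : ∀ (v : ℤ) (k : ℕ),
      (fun j => resWeight (p * q) v (k + j)) = resWeight (p * q) (v - k) := fun v k => by
    funext j
    simp [resWeight, sub_sub]
  rw [polyEval_truncLT_mul, truncProd]
  refine Finset.sum_congr rfl fun e _ => ?_
  rw [hshift, polyEval_truncLT_mul, phiCoeff]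
  congr 1
  refine Finset.sum_congr rfl fun l _ => ?_
  rw [hshift, polyEval_invNum hp2 hpq, phiCoeff]

omit hq htp in
theorem truncProd_comm (i J : ℕ) (u : ℤ) : truncProd p q i J u = truncProd p q J i u := by
  rw [truncProd_eq_polyEval hp.two_le hpq, truncProd_eq_polyEval hp.two_le hpq, mul_left_comm]

omit hpq in
-- Since 1 = tp - q, a constant c contributes -c to the row and ct to the column; ρ and e are the
-- coordinates of u, as q ≡ -1 mod p and t inverts p mod q.
theorem resWeight_eq_cell {u : ℤ} {ρ e : ℕ} (hne : p ≠ q) (hρ : (p : ℤ) ∣ u + ρ)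
    (he : (q : ℤ) ∣ u * t - e) (c j m : ℕ) :
    resWeight (p * q) u (c + j * q + m * p) = cell p q ρ e (j - c) (m + c * t) := by
  have hcop : IsCoprime (p : ℤ) (q : ℤ) :=
    Nat.isCoprime_iff_coprime.2 ((Nat.coprime_primes hp hq).2 hne)
  rw [resWeight, cell]
  refine if_congr ?_ rfl rfl
  have htp' : (t : ℤ) * p = q + 1 := by exact_mod_cast htp
  have h1 : ∀ x : ℤ, ((p * q : ℕ) : ℤ) ∣ x ↔ (p : ℤ) ∣ x ∧ (q : ℤ) ∣ x := fun x => by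
    rw [Nat.cast_mul]
    exact ⟨fun h => ⟨dvd_of_mul_right_dvd h, dvd_of_mul_left_dvd h⟩,
      fun h => hcop.mul_dvd h.1 h.2⟩
  rw [h1]
  obtain ⟨a, ha⟩ := hρ
  obtain ⟨b, hb⟩ := he
  push_cast
  refine and_congr ?_ ?_
  · have h2 : u - (c + j * q + m * p) = (j - c - ρ) + p * (a - j * t - m) := by
      linear_combination ha + (j : ℤ) * htp'
    rw [h2]
    exact dvd_add_left (dvd_mul_right _ _)
  · have h2 : (t : ℤ) * (u - (c + j * q + m * p)) = q * (b - j * t - m) - (m + c * t - e) := by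
      linear_combination hb - (m : ℤ) * htp'
    have h3 : (q : ℤ) ∣ u - (c + j * q + m * p) ↔ (q : ℤ) ∣ t * (u - (c + j * q + m * p)) := by
      refine ⟨fun h => Dvd.dvd.mul_left h _, fun h => ?_⟩
      have h4 := (dvd_sub (Dvd.dvd.mul_left h (p : ℤ))
        (dvd_mul_right (q : ℤ) (u - (c + j * q + m * p))))
      have h5 : (p : ℤ) * (t * (u - (c + j * q + m * p))) - q * (u - (c + j * q + m * p)) =
        u - (c + j * q + m * p) := by linear_combination (u - (c + j * q + m * p)) * htp'
      rwa [h5] at h4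
    rw [h3, h2]
    exact dvd_sub_right (dvd_mul_right _ _)

theorem abs_polyEval_pairSum_le {A A' ε : ℕ} (hA : A < (p - 1) * t) (hA' : A' < (p - 1) * t)
    (hε : ε ≤ 1) (u : ℤ) :
    |polyEval (resWeight (p * q) u) ((pairSum p q t A + (ε : ℤ[X]) * X ^ posExp p q t A) *
      (pairSum p q t A' * invNum p q))| ≤ 1 := by
  have ht := pos_of_mul_eq_succ htp
  have hp0 : (0 : ℤ) < p := by exact_mod_cast hp.pos
  have hq0 : (0 : ℤ) < q := by exact_mod_cast hq.pos
  obtain ⟨ρ, hρ, hρu⟩ : ∃ ρ : ℕ, ρ < p ∧ (p : ℤ) ∣ u + ρ := by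
    refine ⟨((-u) % p).toNat, ?_, ?_⟩
    · have := Int.emod_lt_of_pos (-u) hp0
      omega
    · rw [Int.toNat_of_nonneg (Int.emod_nonneg _ hp0.ne')]
      have h1 : (p : ℤ) ∣ -u - (-u) % p := Int.dvd_self_sub_emod
      rw [← dvd_neg]
      have h2 : -(u + (-u) % p) = -u - (-u) % p := by ring
      rwa [h2]
  obtain ⟨e, he, heu⟩ : ∃ e : ℕ, e < q ∧ (q : ℤ) ∣ u * t - e := by
    refine ⟨((u * t) % q).toNat, ?_, ?_⟩
    · have := Int.emod_lt_of_pos (u * t) hq0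
      omega
    · rw [Int.toNat_of_nonneg (Int.emod_nonneg _ hq0.ne')]
      exact Int.dvd_self_sub_emod
  have hw := resWeight_eq_cell hp hq htp hpq.ne hρu heu
  have hα : A / t + 2 ≤ p := by
    have := (Nat.div_lt_iff_lt_mul ht).2 hA
    omega
  have h := abs_sum_cell_le hp.two_le hpq htp hρ he hα (Nat.mod_lt A ht) hε hA'
  have hdm : A / t * t + A % t = A := Nat.div_add_mod' A t
  rw [hdm] at h
  rw [pairSum_mul_pairSum_mul_invNum ht htp hε]
  convert h using 2
  simp only [sub_mul, one_mul, map_sub, pairSum, pairSumQuot, Finset.mul_sum, mul_sub, map_sum,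
    Finset.sum_sub_distrib, ← pow_add, polyEval_X_pow]
  have e1 : ∀ h, resWeight (p * q) u (posExp p q t h) =
      cell p q ρ e ((h / t : ℕ) + (0 : ℕ)) (h % t : ℕ) := fun h => by
    rw [show posExp p q t h = 0 + h / t * q + h % t * p by rw [posExp]; ring, hw]
    simp
  have e2 : ∀ h, resWeight (p * q) u (h * p + 1) = cell p q ρ e (-1) (t + h) := fun h => by
    rw [show h * p + 1 = 1 + 0 * q + h * p by ring, hw]
    congr 1; push_cast; ring
  have e3 : ∀ h, resWeight (p * q) u ((A / t + 1) * q + posExp p q t h) =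
      cell p q ρ e ((h / t : ℕ) + (A / t + 1 : ℕ)) (h % t : ℕ) := fun h => by
    rw [show (A / t + 1) * q + posExp p q t h = 0 + (h / t + (A / t + 1)) * q + h % t * p by
      rw [posExp]; ring, hw]
    congr 1; push_cast; ring
  have e4 : ∀ h, resWeight (p * q) u ((A / t + 1) * q + (h * p + 1)) =
      cell p q ρ e (A / t : ℕ) (t + h) := fun h => by
    rw [show (A / t + 1) * q + (h * p + 1) = 1 + (A / t + 1) * q + h * p by ring, hw]
    congr 1 <;> push_cast <;> ring
  have e5 : ∀ h, resWeight (p * q) u (posExp p q t A + ε * p + h * p) =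
      cell p q ρ e (A / t : ℕ) ((A % t + ε : ℕ) + h) := fun h => by
    rw [show posExp p q t A + ε * p + h * p = 0 + A / t * q + (A % t + ε + h) * p by
      rw [posExp]; ring, hw]
    congr 1; push_cast; ring
  have e6 : ∀ h, resWeight (p * q) u
      (posExp p q t A + ε * p + (h * p + ((A' - 1 - h) / t + 1) * q)) =
      cell p q ρ e (((A' - 1 - h) / t : ℕ) + (A / t + 1 : ℕ)) ((A % t + ε : ℕ) + h) := fun h => by
    rw [show posExp p q t A + ε * p + (h * p + ((A' - 1 - h) / t + 1) * q) =
      0 + ((A' - 1 - h) / t + (A / t + 1)) * q + (A % t + ε + h) * p by rw [posExp]; ring, hw]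
    congr 1; push_cast; ring
  have e7 : ∀ h, resWeight (p * q) u (A * p + 1 + h * p) =
      cell p q ρ e (-1) ((A + t : ℕ) + h) := fun h => by
    rw [show A * p + 1 + h * p = 1 + 0 * q + (A + h) * p by ring, hw]
    congr 1; push_cast; ring
  have e8 : ∀ h, resWeight (p * q) u (A * p + 1 + (h * p + ((A' - 1 - h) / t + 1) * q)) =
      cell p q ρ e (((A' - 1 - h) / t : ℕ) + (0 : ℕ)) ((A + t : ℕ) + h) := fun h => by
    rw [show A * p + 1 + (h * p + ((A' - 1 - h) / t + 1) * q) =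
      1 + ((A' - 1 - h) / t + 1) * q + (A + h) * p by ring, hw]
    congr 1 <;> push_cast <;> ring
  simp only [e1, e2, e3, e4, e5, e6, e7, e8]
  ring

/-- All products of two truncations of `Φ_{pq}` with `1 / Φ_{pq}` are flat modulo
`X ^ (p * q) - 1` when `q ≡ -1 (mod p)`. -/
theorem abs_truncProd_le (i J : ℕ) (u : ℤ) : |truncProd p q i J u| ≤ 1 := by
  have ht := pos_of_mul_eq_succ htp
  have hbase : ∀ i ≤ primePhi p q, ∀ J ≤ primePhi p q, ∀ u, ∀ A' < (p - 1) * t,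
      truncLT J (cyclotomic (p * q) ℤ) = pairSum p q t A' → |truncProd p q i J u| ≤ 1 := by
    intro i hi J _ u A' hA' hJ
    obtain ⟨A, ε, hA, hε, hiA⟩ := exists_truncLT_cyclotomic_eq hp hq hpq htp hi
    rw [truncProd_eq_polyEval hp.two_le hpq, hJ, hiA]
    exact abs_polyEval_pairSum_le hp hq hpq htp hA hA' hε u
  have heval : ∀ A, (pairSum p q t A).eval 1 = 0 := fun A => by
    rw [pairSum, eval_finsetSum]
    simp
  have hsum : ∀ i, (truncLT i (cyclotomic (p * q) ℤ)).eval 1 = ∑ k ∈ range i, phiCoeff p q k :=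
    fun i => by
      rw [truncLT, eval_finsetSum]
      simp [phiCoeff]
  have htotal : ∑ k ∈ range (primePhi p q + 1), phiCoeff p q k = 1 := by
    have h1 := eval_eq_sum_range (p := cyclotomic (p * q) ℤ) 1
    rw [natDegree_cyclotomic_mul hp hq hpq] at h1
    simp only [one_pow, mul_one] at h1
    rw [cyclotomic_eq_pairSum_add ht htp hp hq hpq, eval_add, heval, eval_pow, eval_X, one_pow,
      zero_add, ← cyclotomic_eq_pairSum_add ht htp hp hq hpq] at h1
    exact h1.symm
  -- Evaluate at 1: pairs contribute 0 and Φ_{pq}(1) = 1, so exactly one of two complementary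
  -- truncations has an unpaired term.
  have hrefl : ∀ i, 1 ≤ i → i ≤ primePhi p q → ∀ A,
      truncLT i (cyclotomic (p * q) ℤ) = pairSum p q t A + X ^ posExp p q t A →
      ∃ A' < (p - 1) * t,
        truncLT (primePhi p q + 1 - i) (cyclotomic (p * q) ℤ) = pairSum p q t A' := by
    intro i hi hi' A hA
    obtain ⟨A', ε, hA', hε, hiA'⟩ := exists_truncLT_cyclotomic_eq hp hq hpq htp
      (i := primePhi p q + 1 - i) (by omega)
    refine ⟨A', hA', ?_⟩
    have h1 := sum_phiCoeff_reflect hp hq hpq (J := i) (by omega) (fun _ => 1)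
    simp only [mul_one] at h1
    rw [htotal, ← hsum, ← hsum, hA, hiA', eval_add, eval_add, heval, heval] at h1
    simp only [eval_mul, eval_pow, eval_X, one_pow, mul_one, eval_natCast, zero_add] at h1
    obtain rfl : ε = 0 := by omega
    rw [hiA', Nat.cast_zero, zero_mul, add_zero]
  rcases Nat.lt_or_ge (primePhi p q) i with hi | hi
  · rw [truncProd_comm hp hpq, truncProd]
    simp [sum_phiCoeff_invCoeff hp hq hpq hi]
  rcases Nat.lt_or_ge (primePhi p q) J with hJ | hJ
  · rw [truncProd]
    simp [sum_phiCoeff_invCoeff hp hq hpq hJ]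
  rcases Nat.eq_zero_or_pos i with rfl | hi0
  · simp [truncProd]
  rcases Nat.eq_zero_or_pos J with rfl | hJ0
  · simp [truncProd]
  obtain ⟨A, ε, hA, hε, hiA⟩ := exists_truncLT_cyclotomic_eq hp hq hpq htp hi
  obtain ⟨A', ε', hA', hε', hJA⟩ := exists_truncLT_cyclotomic_eq hp hq hpq htp hJ
  obtain rfl | rfl : ε' = 0 ∨ ε' = 1 := by omega
  · exact hbase i hi J hJ u A' hA' (by simpa using hJA)
  obtain rfl | rfl : ε = 0 ∨ ε = 1 := by omega
  · rw [truncProd_comm hp hpq]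
    exact hbase J hJ i hi u A hA (by simpa using hiA)
  -- Both truncations have an unpaired term; after reflection the second has none.
  obtain ⟨A₂, hA₂, hJ₂⟩ := hrefl J hJ0 hJ A' (by simpa using hJA)
  rw [truncProd_reflect hp hq hpq (by omega), abs_neg]
  exact hbase _ (by omega) _ (by omega) _ A₂ hA₂ hJ₂

end

theorem mainTheorem3 (p q r s : ℕ)
    (hp : p.Prime) (hq : q.Prime) (hr : r.Prime) (hs : s.Prime)
    (hpq : p < q) (hqr : q < r) (hrs : r < s)
    (hr_mod : (r : ℤ) ≡ 1 [ZMOD (p * q : ℤ)] ∨ (r : ℤ) ≡ -1 [ZMOD (p * q : ℤ)])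
    (hs_mod : (s : ℤ) ≡ 1 [ZMOD (p * q * r : ℤ)] ∨ (s : ℤ) ≡ -1 [ZMOD (p * q * r : ℤ)]) :
    (Polynomial.cyclotomic (p * q * r * s) ℤ).IsFlat ↔ (q : ℤ) ≡ -1 [ZMOD (p : ℤ)] := by
  have hp2 := hp.two_le
  have hη : ((p * q : ℕ) : ℤ) ∣ r - 1 ∨ ((p * q : ℕ) : ℤ) ∣ r + 1 := by
    rw [Nat.cast_mul]
    exact hr_mod.imp (fun h => Int.modEq_iff_dvd.1 h.symm)
      (fun h => by simpa using Int.modEq_iff_dvd.1 h.symm)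
  have hσ : ((p * q * r : ℕ) : ℤ) ∣ s - 1 ∨ ((p * q * r : ℕ) : ℤ) ∣ s + 1 := by
    rw [Nat.cast_mul, Nat.cast_mul]
    exact hs_mod.imp (fun h => Int.modEq_iff_dvd.1 h.symm)
      (fun h => by simpa using Int.modEq_iff_dvd.1 h.symm)
  have hphi : primePhi p q < r := by
    have h1 := phi_add hp2 hpq
    rcases hη with h | h
    · have := Int.le_of_dvd (by omega) h
      omega
    · have := Int.le_of_dvd (by omega) h
      omega
  have hpos : 1 < p * q * r * s := by
    have h1 : 1 ≤ p * q * r := Nat.mul_pos (Nat.mul_pos hp.pos hq.pos) hr.pos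
    calc 1 < s := hs.one_lt
      _ = 1 * s := (one_mul s).symm
      _ ≤ p * q * r * s := Nat.mul_le_mul_right s h1
  rw [Polynomial.isFlat_iff_of_coeff_zero (cyclotomic_coeff_zero ℤ hpos)]
  constructor
  · intro hflat
    by_contra hmod
    obtain ⟨i, J, u, hi, hi', hJ, hJ', hu, hu', h2⟩ := exists_truncProd_eq_two hp hq hpq hmod
    obtain ⟨k, hk⟩ := exists_abs_coeff_cyclotomic_four_eq hp hq hr hs hpq hqr hrs hphi hη hσ
      hi hi' hJ hJ' hu hu'
    have h3 := hflat k
    rw [hk, h2] at h3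
    norm_num at h3
  · intro hmod k
    have h1 : (p : ℤ) ∣ (q + 1 : ℕ) := by
      have := Int.modEq_iff_dvd.1 hmod.symm
      simpa using this
    obtain ⟨t, ht⟩ := Int.natCast_dvd_natCast.1 h1
    exact abs_coeff_cyclotomic_four_le hp hq hr hs hpq hqr hrs hphi hη hσ
      (abs_truncProd_le hp hq hpq (by rw [mul_comm]; exact ht.symm)) k
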